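/- Let $K\subset\mathbb{R}^3$ be a convex body (a compact convex set with nonempty interior) that is centrally symmetric, $K=-K$. Assume that the boundary $\partial K$ is a $C^\infty$ hypersurface and that $K$ is strongly convex, i.e. for $h_K=\tfrac12\mu_K^2$, where $\mu_K(x)=\min\{\lambda\ge 0 : x\in\lambda K\}$ is the Minkowski gauge of $K$, the Hessian matrix $D^2h_K(x)$ is positive definite for every $x$ with $|x|=1$. If $K$ is symmetric with respect to a plane (i.e. $K$ is invariant under the orthogonal reflection in some plane of $\mathbb{R}^3$), then its volume product satisfies $$\mathcal{P}(K):=\min_{z\in\operatorname{int}K}|K|\,|K^z|\ \ge\ \frac{32}{3},$$ where $|\cdot|$ denotes three-dimensional volume and $K^z=\{y\in\mathbb{R}^3 : (y-z)\cdot(x-z)\le 1\text{ for all }x\in K\}$ is the polar body of $K$ with respect to $z$. -/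

import Mathlib

open scoped ENNReal Pointwise ContDiff

/-- A convex body in `ℝⁿ`: a compact convex set with nonempty interior. -/
structure IsConvexBody {n : ℕ} (K : Set (EuclideanSpace ℝ (Fin n))) : Prop where
  convex : Convex ℝ K
  isCompact : IsCompact K
  interior_nonempty : (interior K).Nonempty

/-- `K = -K`. -/
def IsCentrallySymmetric {n : ℕ} (K : Set (EuclideanSpace ℝ (Fin n))) : Prop :=
  K = -K

/-- The polar body of `K` with respect to `z`: all `y` with
`(y - z) · (x - z) ≤ 1` for every `x ∈ K`. -/
def polarBody {n : ℕ} (K : Set (EuclideanSpace ℝ (Fin n))) (z : EuclideanSpace ℝ (Fin n)) :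
    Set (EuclideanSpace ℝ (Fin n)) :=
  {y | ∀ x ∈ K, inner ℝ (y - z) (x - z) ≤ 1}

/-- The volume product: the minimum over `z ∈ int K` of `|K| |K^z|`, as an infimum in `[0, ∞]`. -/
noncomputable def volumeProduct {n : ℕ} (K : Set (EuclideanSpace ℝ (Fin n))) : ℝ≥0∞ :=
  ⨅ z ∈ interior K, MeasureTheory.volume K * MeasureTheory.volume (polarBody K z)

/-- `M` is a `C^∞` hypersurface in `ℝⁿ`: near each of its points it is the zero set of a
`C^∞` function whose differential does not vanish at that point. -/
def IsSmoothHypersurface {n : ℕ} (M : Set (EuclideanSpace ℝ (Fin n))) : Prop :=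
  ∀ p ∈ M, ∃ (U : Set (EuclideanSpace ℝ (Fin n))) (f : EuclideanSpace ℝ (Fin n) → ℝ),
    IsOpen U ∧ p ∈ U ∧ ContDiffOn ℝ ∞ f U ∧ fderiv ℝ f p ≠ 0 ∧ M ∩ U = {x ∈ U | f x = 0}

/-- `h_K = μ_K² / 2`, where `μ_K` is the Minkowski gauge of `K`. -/
noncomputable def halfSqGauge {n : ℕ} (K : Set (EuclideanSpace ℝ (Fin n)))
    (x : EuclideanSpace ℝ (Fin n)) : ℝ :=
  gauge K x ^ 2 / 2

/-- Strong convexity of a body with smooth boundary and the origin in its interior: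
the Hessian of `h_K` is positive definite at every point of the unit sphere. -/
def IsStronglyConvexBody {n : ℕ} (K : Set (EuclideanSpace ℝ (Fin n))) : Prop :=
  ∀ x : EuclideanSpace ℝ (Fin n), ‖x‖ = 1 → ∀ v : EuclideanSpace ℝ (Fin n), v ≠ 0 →
    0 < fderiv ℝ (fderiv ℝ (halfSqGauge K)) x v v

/-!
Write `P(K) = |K| |K°|` for a symmetric convex body `K` in `ℝᵐ`, where `K°` is its polar at the
origin. Suppose that the coordinate hyperplanes cut both `K` and each of its coordinate sections
`Kᵢ = K ∩ eᵢ^⊥` into pieces of equal volume. For `x ∈ K` in the orthant `ε`, the cones with apex `x`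
over the pieces of the sections in that orthant are disjoint and lie in the piece of `K` in that
orthant; comparing volumes, the box with half-sides `cᵢ = 2 |Kᵢ| / (m |K|)` lies in `K°`. The mixed
volume of `K°` with this box is then at most `|K°|`, which reads `∑ 2 cᵢ |projᵢ K°| ≤ m |K°|`.
Since `projᵢ K°` is the polar of `Kᵢ`, this gives `m² P(K) ≥ 4 ∑ P(Kᵢ)`, so that `P ≥ 4` on the line
yields `P ≥ 8` in the plane and `P ≥ 32 / 3` in space whenever a linear change of coordinates, which
leaves `P` invariant, achieves the equipartition.

In the plane an intermediate value argument produces two lines which cut two given even measures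
into quarters simultaneously. For a body invariant under reflection in a plane `H`, take as these
measures its section by `H` and its projection to `H`; the reflection settles the two remaining
sections and the halves of the body on the two sides of `H`.

Finally `|K^z| ≥ |K°|` for every interior point `z`: the projective map `y ↦ y / (1 - ⟪z, y⟫)` sends
`K°` into `K^z - z`, and the sum of its Jacobians at `y` and `-y` is at least `2`.
-/

open MeasureTheory Set

namespace VolumeProduct

section Coordinates

variable {n : ℕ} (i : Fin (n + 1))

lemma insertNth_smul (c s : ℝ) (p : Fin n → ℝ) :
    (i.insertNth (c * s) (c • p) : Fin (n + 1) → ℝ) = c • i.insertNth s p := by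
  simp [funext_iff, Fin.forall_iff_succAbove i]

lemma continuous_insertNth :
    Continuous fun q : ℝ × (Fin n → ℝ) ↦ (i.insertNth q.1 q.2 : Fin (n + 1) → ℝ) := by
  fun_prop

lemma continuous_removeNth : Continuous fun x : Fin (n + 1) → ℝ ↦ i.removeNth x := by
  unfold Fin.removeNth
  fun_prop

lemma measurePreserving_insertNth :
    MeasurePreserving
      (fun q : ℝ × (Fin n → ℝ) ↦ (i.insertNth q.1 q.2 : Fin (n + 1) → ℝ)) volume volume :=
  (volume_preserving_piFinSuccAbove (fun _ ↦ ℝ) i).symm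

lemma volume_eq_lintegral_volume_fiber {S : Set (Fin (n + 1) → ℝ)} (hS : MeasurableSet S) :
    volume S = ∫⁻ p : Fin n → ℝ, volume {s | i.insertNth s p ∈ S} := by
  rw [← (measurePreserving_insertNth i).measure_preimage hS.nullMeasurableSet,
    Measure.volume_eq_prod, Measure.prod_apply_symm ((continuous_insertNth i).measurable hS)]
  rfl

lemma volume_eq_lintegral_volume_section {S : Set (Fin (n + 1) → ℝ)} (hS : MeasurableSet S) :
    volume S = ∫⁻ s : ℝ, volume {p | i.insertNth s p ∈ S} := by
  rw [← (measurePreserving_insertNth i).measure_preimage hS.nullMeasurableSet,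
    Measure.volume_eq_prod, Measure.prod_apply ((continuous_insertNth i).measurable hS)]
  rfl

/-- The section of `K` by the `i`-th coordinate hyperplane, as a subset of `ℝⁿ`. -/
def coordSlice (K : Set (Fin (n + 1) → ℝ)) : Set (Fin n → ℝ) := {p | i.insertNth 0 p ∈ K}

/-- The orthogonal projection of `K` onto the `i`-th coordinate hyperplane, as a subset of `ℝⁿ`. -/
def coordProj (K : Set (Fin (n + 1) → ℝ)) : Set (Fin n → ℝ) := i.removeNth '' K

lemma mem_coordProj {K : Set (Fin (n + 1) → ℝ)} {p : Fin n → ℝ} :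
    p ∈ coordProj i K ↔ ∃ s, i.insertNth s p ∈ K := by
  constructor
  · rintro ⟨x, hx, rfl⟩
    exact ⟨x i, by rwa [Fin.insertNth_self_removeNth]⟩
  · rintro ⟨s, hs⟩
    exact ⟨_, hs, Fin.removeNth_insertNth (α := fun _ ↦ ℝ) i s p⟩

lemma isCompact_coordProj {K : Set (Fin (n + 1) → ℝ)} (hK : IsCompact K) :
    IsCompact (coordProj i K) :=
  hK.image (continuous_removeNth i)

lemma isCompact_fiber {K : Set (Fin (n + 1) → ℝ)} (hK : IsCompact K) (p : Fin n → ℝ) :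
    IsCompact {s | i.insertNth s p ∈ K} := by
  refine (hK.image (continuous_apply i)).of_isClosed_subset (hK.isClosed.preimage ?_) ?_
  · fun_prop
  · exact fun s hs ↦ ⟨_, hs, by simp⟩

end Coordinates

section MixedVolume

lemma volume_add_le_volume_add_Icc {F : Set ℝ} (hF : IsCompact F) (hne : F.Nonempty) {c : ℝ}
    (hc : 0 ≤ c) : volume F + ENNReal.ofReal (2 * c) ≤ volume (F + Icc (-c) c) := by
  obtain ⟨a, haF, ha⟩ := hF.exists_isLeast hne
  have hdisj : Disjoint ((c + ·) '' F) (Ico (a - c) (a + c)) := by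
    rw [Set.disjoint_left]
    rintro _ ⟨s, hs, rfl⟩ hs'
    linarith [ha hs, hs'.2]
  calc volume F + ENNReal.ofReal (2 * c)
      = volume ((c + ·) '' F) + volume (Ico (a - c) (a + c)) := by
        rw [image_add_left, measure_preimage_add, Real.volume_Ico]
        ring_nf
    _ = volume ((c + ·) '' F ∪ Ico (a - c) (a + c)) :=
        (measure_union hdisj measurableSet_Ico).symm
    _ ≤ volume (F + Icc (-c) c) := by
        refine measure_mono (union_subset ?_ fun s hs ↦ ?_)
        · rintro _ ⟨s, hs, rfl⟩
          exact ⟨s, hs, c, ⟨by linarith, le_rfl⟩, add_comm s c⟩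
        · exact ⟨a, haF, s - a, ⟨by linarith [hs.1], by linarith [hs.2]⟩, by simp⟩

variable {n : ℕ}

lemma volume_add_mul_volume_coordProj_le (i : Fin (n + 1)) {M : Set (Fin (n + 1) → ℝ)}
    (hM : IsCompact M) {c : ℝ} (hc : 0 ≤ c) :
    volume M + ENNReal.ofReal (2 * c) * volume (coordProj i M) ≤
      volume (M + Pi.single i '' Icc (-c) c) := by
  have hN : IsCompact (M + Pi.single i '' Icc (-c) c) :=
    hM.add (isCompact_Icc.image (continuous_single (A := fun _ ↦ ℝ) i))
  have hp := (isCompact_coordProj i hM).measurableSet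
  rw [volume_eq_lintegral_volume_fiber i hM.measurableSet,
    volume_eq_lintegral_volume_fiber i hN.measurableSet,
    ← lintegral_indicator_const hp, ← lintegral_add_right _ (measurable_const.indicator hp)]
  refine lintegral_mono fun p ↦ ?_
  by_cases hpM : p ∈ coordProj i M
  · simp only [indicator_of_mem hpM]
    refine (volume_add_le_volume_add_Icc (isCompact_fiber i hM p) ((mem_coordProj i).1 hpM)
      hc).trans (measure_mono ?_)
    rintro _ ⟨s, hs, r, hr, rfl⟩
    refine ⟨_, hs, _, mem_image_of_mem _ hr, ?_⟩
    change (i.insertNth s p + Pi.single i r : Fin (n + 1) → ℝ) = i.insertNth (s + r) p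
    rw [← Fin.insertNth_zero_right, ← Fin.insertNth_add, add_zero]
  · have hempty : {s | i.insertNth s p ∈ M} = ∅ :=
      eq_empty_of_forall_notMem fun s hs ↦ hpM ((mem_coordProj i).2 ⟨s, hs⟩)
    simp [indicator_of_notMem hpM, hempty]

lemma volume_real_add_sum_mul_volume_coordProj_le {L : Set (Fin (n + 1) → ℝ)} (hL : IsCompact L)
    {c : Fin (n + 1) → ℝ} (hc : 0 ≤ c) (S : Finset (Fin (n + 1))) :
    volume.real L + ∑ i ∈ S, 2 * c i * volume.real (coordProj i L) ≤
      volume.real (L + ∑ i ∈ S, Pi.single i '' Icc (-c i) (c i)) := by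
  induction S using Finset.induction_on generalizing L with
  | empty => simp
  | insert i S hi ih =>
    set A : Set (Fin (n + 1) → ℝ) := Pi.single i '' Icc (-c i) (c i)
    have hLA : IsCompact (L + A) :=
      hL.add (isCompact_Icc.image (continuous_single (A := fun _ ↦ ℝ) i))
    have hsub : L ⊆ L + A :=
      subset_add_left L ⟨0, ⟨neg_nonpos.2 (hc i), hc i⟩, Pi.single_zero i⟩
    have haxis : volume.real L + 2 * c i * volume.real (coordProj i L) ≤ volume.real (L + A) := by
      have h := ENNReal.toReal_mono hLA.measure_lt_top.ne
        (volume_add_mul_volume_coordProj_le i hL (hc i))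
      rwa [ENNReal.toReal_add hL.measure_lt_top.ne (ENNReal.mul_ne_top ENNReal.ofReal_ne_top
        (isCompact_coordProj i hL).measure_lt_top.ne), ENNReal.toReal_mul,
        ENNReal.toReal_ofReal (mul_nonneg zero_le_two (hc i))] at h
    have hproj : ∀ j, volume.real (coordProj j L) ≤ volume.real (coordProj j (L + A)) := fun j ↦
      measureReal_mono (image_mono hsub) (isCompact_coordProj j hLA).measure_lt_top.ne
    rw [Finset.sum_insert hi, Finset.sum_insert hi, ← add_assoc, ← add_assoc]
    exact (add_le_add haxis (Finset.sum_le_sum fun j _ ↦ mul_le_mul_of_nonneg_left (hproj j)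
      (mul_nonneg zero_le_two (hc j)))).trans (ih hLA)

lemma sum_image_single_subset_Icc (c : Fin n → ℝ) :
    ∑ i, Pi.single i '' Icc (-c i) (c i) ⊆ Icc (-c) c := by
  intro y hy
  obtain ⟨g, hg, rfl⟩ := (mem_fintype_sum _ _).1 hy
  choose r hr hrg using hg
  have hsum : ∑ i, g i = r := by
    rw [← Finset.univ_sum_single r]
    exact Finset.sum_congr rfl fun i _ ↦ (hrg i).symm
  rw [hsum]
  exact ⟨fun i ↦ (hr i).1, fun i ↦ (hr i).2⟩

lemma le_mul_of_forall_add_mul_le_pow {m : ℕ} {V B : ℝ}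
    (h : ∀ t : ℝ, 0 < t → V + t * B ≤ (1 + t) ^ m * V) : B ≤ m * V := by
  have hderiv : HasDerivAt (fun t : ℝ ↦ (1 + t) ^ m * V) (m * V) 0 := by
    simpa using (((hasDerivAt_id (0 : ℝ)).const_add 1).pow m).mul_const V
  refine ge_of_tendsto hderiv.tendsto_slope_zero_right ?_
  filter_upwards [self_mem_nhdsWithin] with t (ht : 0 < t)
  simp only [zero_add, add_zero, one_pow, one_mul, smul_eq_mul]
  rw [inv_mul_eq_div, le_div_iff₀ ht]
  linarith [h t ht]

-- The left-hand side is `n + 1` times the mixed volume of `n` copies of `L` with the box,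
-- hence the derivative at `0` of `t ↦ volume (L + t • box)`, and `L + t • box ⊆ (1 + t) • L`.
theorem sum_mul_volume_coordProj_le {L : Set (Fin (n + 1) → ℝ)} (hL : IsCompact L)
    (hconv : Convex ℝ L) {c : Fin (n + 1) → ℝ} (hc : 0 ≤ c) (hbox : Icc (-c) c ⊆ L) :
    ∑ i, 2 * c i * volume.real (coordProj i L) ≤ (n + 1) * volume.real L := by
  have hpow : ∀ t : ℝ, 0 < t → volume.real L +
      t * ∑ i, 2 * c i * volume.real (coordProj i L) ≤ (1 + t) ^ (n + 1) * volume.real L := by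
    intro t ht
    have hsub : Icc (-(t • c)) (t • c) ⊆ t • L := by
      rw [← smul_neg]
      exact ((OrderIso.smulRight ht).image_Icc (-c) c).ge.trans (image_mono hbox)
    calc volume.real L + t * ∑ i, 2 * c i * volume.real (coordProj i L)
        = volume.real L + ∑ i, 2 * (t • c) i * volume.real (coordProj i L) := by
          rw [Finset.mul_sum]
          congr! 2 with i
          simp only [Pi.smul_apply, smul_eq_mul]
          ring
      _ ≤ volume.real (L + ∑ i, Pi.single i '' Icc (-(t • c) i) ((t • c) i)) :=
          volume_real_add_sum_mul_volume_coordProj_le hL (smul_nonneg ht.le hc) Finset.univ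
      _ ≤ volume.real ((1 + t) • L) := by
          refine measureReal_mono ?_ (hL.smul _).measure_lt_top.ne
          rw [hconv.add_smul zero_le_one ht.le, one_smul]
          exact add_subset_add_left ((sum_image_single_subset_Icc _).trans hsub)
      _ = (1 + t) ^ (n + 1) * volume.real L := by
          rw [measureReal_def, Measure.addHaar_smul, ENNReal.toReal_mul,
            ENNReal.toReal_ofReal (abs_nonneg _), Module.finrank_fin_fun,
            abs_of_pos (by positivity), measureReal_def]
  exact_mod_cast le_mul_of_forall_add_mul_le_pow hpow

end MixedVolume

section Orthants

variable {n : ℕ}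

/-- The open coordinate orthant of `ℝⁿ` with sign vector `ε`. -/
def orthant (ε : Fin n → ℤˣ) : Set (Fin n → ℝ) := {y | ∀ i, 0 < ε i • y i}

lemma isOpen_orthant (ε : Fin n → ℤˣ) : IsOpen (orthant ε) := by
  simp only [orthant, ofPred_forall]
  exact isOpen_iInter_of_finite fun i ↦ isOpen_lt continuous_const (by fun_prop)

lemma measurableSet_coordSlice (i : Fin (n + 1)) {K : Set (Fin (n + 1) → ℝ)}
    (hK : MeasurableSet K) : MeasurableSet (coordSlice i K) :=
  ((continuous_insertNth i).comp (Continuous.prodMk_right (0 : ℝ))).measurable hK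

end Orthants

section Pyramids

variable {n : ℕ} {i : Fin (n + 1)} {x y : Fin (n + 1) → ℝ} {Q : Set (Fin n → ℝ)}

/-- The open pyramid with base `Q` in the `i`-th coordinate hyperplane and apex `x`, that is the
set of the points `y = (1 - t) • q + t • x` with `q ∈ Q` and `0 < t < 1`. Then `t = y i / x i`, so
the pyramid is empty if `x i = 0`, when this quotient is `0`. -/
def pyramid (i : Fin (n + 1)) (x : Fin (n + 1) → ℝ) (Q : Set (Fin n → ℝ)) :
    Set (Fin (n + 1) → ℝ) :=
  {y | y i / x i ∈ Ioo 0 1 ∧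
    (1 - y i / x i)⁻¹ • (i.removeNth y - (y i / x i) • i.removeNth x) ∈ Q}

lemma measurableSet_pyramid (i : Fin (n + 1)) (x : Fin (n + 1) → ℝ) (hQ : MeasurableSet Q) :
    MeasurableSet (pyramid i x Q) := by
  have ht : Measurable fun y : Fin (n + 1) → ℝ ↦ y i / x i := by fun_prop
  have hremove := (continuous_removeNth i).measurable
  have hbase : Measurable fun y : Fin (n + 1) → ℝ ↦
      (1 - y i / x i)⁻¹ • (i.removeNth y - (y i / x i) • i.removeNth x) := by
    fun_prop
  exact (ht measurableSet_Ioo).inter (hbase hQ)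

lemma lintegral_one_sub_pow (n : ℕ) :
    ∫⁻ t in Ioo (0 : ℝ) 1, ENNReal.ofReal ((1 - t) ^ n) = ENNReal.ofReal (1 / (n + 1)) := by
  rw [← ofReal_integral_eq_lintegral_ofReal]
  · rw [← integral_Ioc_eq_integral_Ioo, ← intervalIntegral.integral_of_le zero_le_one,
      intervalIntegral.integral_comp_sub_left (fun t ↦ t ^ n)]
    simp
  · exact (Continuous.integrableOn_Icc (by fun_prop)).mono_set Ioo_subset_Icc_self
  · filter_upwards [self_mem_ae_restrict measurableSet_Ioo] with t ht
    exact pow_nonneg (sub_nonneg.2 ht.2.le) _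

lemma volume_preimage_inv_smul_sub {r : ℝ} (hr : 0 < r) (v : Fin n → ℝ) (Q : Set (Fin n → ℝ)) :
    volume {p | r⁻¹ • (p - v) ∈ Q} = ENNReal.ofReal (r ^ n) * volume Q := by
  have h : {p | r⁻¹ • (p - v) ∈ Q} = v +ᵥ r • Q := by
    ext p
    rw [mem_vadd_set_iff_neg_vadd_mem, mem_smul_set_iff_inv_smul_mem₀ hr.ne', vadd_eq_add,
      neg_add_eq_sub, mem_ofPred_eq]
  rw [h, measure_vadd, Measure.addHaar_smul_of_nonneg _ hr.le, Module.finrank_fin_fun]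

lemma volume_section_pyramid (i : Fin (n + 1)) (x : Fin (n + 1) → ℝ) (Q : Set (Fin n → ℝ))
    (s : ℝ) : volume {p | i.insertNth s p ∈ pyramid i x Q} =
      (Ioo 0 1).indicator (fun t ↦ ENNReal.ofReal ((1 - t) ^ n) * volume Q) (s / x i) := by
  by_cases hs : s / x i ∈ Ioo 0 1
  · rw [indicator_of_mem hs,
      ← volume_preimage_inv_smul_sub (sub_pos.2 hs.2) ((s / x i) • i.removeNth x)]
    congr 1
    ext p
    simp only [pyramid, mem_ofPred_eq, Fin.insertNth_apply_same, Fin.removeNth_insertNth, hs,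
      true_and]
  · have hempty : {p | i.insertNth s p ∈ pyramid i x Q} = ∅ :=
      eq_empty_of_forall_notMem fun p hp ↦ hs (by simpa using hp.1)
    rw [hempty, measure_empty, indicator_of_notMem hs]

lemma volume_pyramid (i : Fin (n + 1)) (x : Fin (n + 1) → ℝ) (hQ : MeasurableSet Q) :
    (n + 1) * volume (pyramid i x Q) = ENNReal.ofReal |x i| * volume Q := by
  rcases eq_or_ne (x i) 0 with hx | hx
  · simp [pyramid, hx]
  have hmeas : Measurable
      ((Ioo (0 : ℝ) 1).indicator fun t ↦ ENNReal.ofReal ((1 - t) ^ n) * volume Q) :=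
    Measurable.indicator (by fun_prop) measurableSet_Ioo
  have hinv : (n + 1 : ℝ≥0∞) * ENNReal.ofReal (1 / (n + 1)) = 1 := by
    rw [one_div, ENNReal.ofReal_inv_of_pos (by positivity), ENNReal.ofReal_add (by positivity)
      zero_le_one, ENNReal.ofReal_natCast, ENNReal.ofReal_one]
    exact ENNReal.mul_inv_cancel (by simp) (by simp)
  have hvol : volume (pyramid i x Q) =
      ENNReal.ofReal |x i| * (ENNReal.ofReal (1 / (n + 1)) * volume Q) := by
    simp only [volume_eq_lintegral_volume_section i (measurableSet_pyramid i x hQ),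
      volume_section_pyramid, div_eq_mul_inv _ (x i)]
    rw [← lintegral_map hmeas (measurable_mul_const _), Real.map_volume_mul_right (inv_ne_zero hx),
      lintegral_smul_measure, lintegral_indicator measurableSet_Ioo,
      lintegral_mul_const _ (by fun_prop), lintegral_one_sub_pow, inv_inv, smul_eq_mul]
  rw [hvol, mul_left_comm, ← mul_assoc (_ + 1 : ℝ≥0∞), hinv, one_mul]

lemma ne_zero_of_mem_pyramid (hy : y ∈ pyramid i x Q) : x i ≠ 0 :=
  fun hx ↦ by simp [pyramid, hx] at hy

lemma pyramid_mono {Q' : Set (Fin n → ℝ)} (h : Q ⊆ Q') : pyramid i x Q ⊆ pyramid i x Q' :=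
  fun _ hy ↦ ⟨hy.1, h hy.2⟩

lemma pyramid_coordSlice_subset {K : Set (Fin (n + 1) → ℝ)} (hK : Convex ℝ K) (hx : x ∈ K) :
    pyramid i x (coordSlice i K) ⊆ K := by
  intro y hy
  have ht : 0 < 1 - y i / x i := sub_pos.2 hy.1.2
  convert hK hy.2 hx ht.le hy.1.1.le (sub_add_cancel 1 _)
  rw [← insertNth_smul, mul_zero, smul_inv_smul₀ ht.ne']
  ext k
  rcases Fin.eq_self_or_eq_succAbove i k with rfl | ⟨j, rfl⟩
  · simp [ne_zero_of_mem_pyramid hy]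
  · simp [Fin.removeNth]

-- On the pyramid over the `i`-th coordinate hyperplane the ratio `y k / x k` is smallest for
-- `k = i`; this makes the pyramids over the different coordinate hyperplanes disjoint.
lemma mul_smul_lt_smul_of_mem_pyramid {ε : Fin (n + 1) → ℤˣ}
    (hy : y ∈ pyramid i x (orthant (i.removeNth ε))) {k : Fin (n + 1)} (hk : k ≠ i) :
    y i / x i * ε k • x k < ε k • y k := by
  obtain ⟨j, rfl⟩ := Fin.exists_succAbove_eq hk
  have h := hy.2 j
  simp only [Fin.removeNth, Pi.smul_apply, Pi.sub_apply, smul_eq_mul, ← mul_smul_comm,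
    smul_sub] at h
  exact sub_pos.1 (pos_of_mul_pos_right h (inv_pos.2 (sub_pos.2 hy.1.2)).le)

variable {ε : Fin (n + 1) → ℤˣ}

lemma div_mul_smul_self (hx : x i ≠ 0) : y i / x i * ε i • x i = ε i • y i := by
  rw [mul_smul_comm, div_mul_cancel₀ _ hx]

lemma pyramid_orthant_subset (hx : ∀ k, 0 ≤ ε k • x k) :
    pyramid i x (orthant (i.removeNth ε)) ⊆ orthant ε := by
  intro y hy k
  rcases eq_or_ne k i with rfl | hk
  · have hxk := ne_zero_of_mem_pyramid hy
    rw [← div_mul_smul_self hxk]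
    exact mul_pos hy.1.1 ((hx k).lt_of_ne' ((smul_ne_zero_iff_ne _).2 hxk))
  · exact (mul_nonneg hy.1.1.le (hx k)).trans_lt (mul_smul_lt_smul_of_mem_pyramid hy hk)

lemma disjoint_pyramid_orthant (hx : ∀ k, 0 ≤ ε k • x k) {k : Fin (n + 1)} (hik : i ≠ k) :
    Disjoint (pyramid i x (orthant (i.removeNth ε))) (pyramid k x (orthant (k.removeNth ε))) := by
  refine Set.disjoint_left.2 fun y hyi hyk ↦ ?_
  have hlt := mul_smul_lt_smul_of_mem_pyramid hyi hik.symm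
  have hgt := mul_smul_lt_smul_of_mem_pyramid hyk hik
  rw [← div_mul_smul_self (y := y) (ne_zero_of_mem_pyramid hyk)] at hlt
  rw [← div_mul_smul_self (y := y) (ne_zero_of_mem_pyramid hyi)] at hgt
  exact lt_asymm (lt_of_mul_lt_mul_right hlt (hx k)) (lt_of_mul_lt_mul_right hgt (hx i))

theorem sum_mul_volume_coordSlice_inter_orthant_le {K : Set (Fin (n + 1) → ℝ)}
    (hK : IsCompact K) (hconv : Convex ℝ K) (hxK : x ∈ K) (hx : ∀ k, 0 ≤ ε k • x k) :
    ∑ i, |x i| * volume.real (coordSlice i K ∩ orthant (i.removeNth ε)) ≤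
      (n + 1) * volume.real (K ∩ orthant ε) := by
  set Q : Fin (n + 1) → Set (Fin n → ℝ) := fun i ↦ coordSlice i K ∩ orthant (i.removeNth ε)
  have hQ (i) : MeasurableSet (Q i) :=
    (measurableSet_coordSlice i hK.measurableSet).inter (isOpen_orthant _).measurableSet
  have hvol (i) : |x i| * volume.real (Q i) = (n + 1) * volume.real (pyramid i x (Q i)) := by
    simpa [measureReal_def, ENNReal.toReal_add] using
      congrArg ENNReal.toReal (volume_pyramid i x (hQ i)).symm
  have hdisj : Pairwise (Function.onFun Disjoint fun i ↦ pyramid i x (Q i)) := fun _ _ hik ↦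
    (disjoint_pyramid_orthant hx hik).mono
      (pyramid_mono inter_subset_right) (pyramid_mono inter_subset_right)
  have hsub (i) : pyramid i x (Q i) ⊆ K ∩ orthant ε := subset_inter
    ((pyramid_mono inter_subset_left).trans (pyramid_coordSlice_subset hconv hxK))
    ((pyramid_mono inter_subset_right).trans (pyramid_orthant_subset hx))
  have hfin : volume (K ∩ orthant ε) ≠ ⊤ :=
    measure_inter_ne_top_of_left_ne_top hK.measure_lt_top.ne
  calc ∑ i, |x i| * volume.real (Q i)
      = (n + 1) * volume.real (⋃ i, pyramid i x (Q i)) := by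
        rw [measureReal_iUnion_fintype hdisj (fun i ↦ measurableSet_pyramid i x (hQ i))
          fun i ↦ measure_ne_top_of_subset (hsub i) hfin, Finset.mul_sum]
        exact Finset.sum_congr rfl fun i _ ↦ hvol i
    _ ≤ (n + 1) * volume.real (K ∩ orthant ε) := by
        gcongr
        exact iUnion_subset hsub

end Pyramids

section SymmetricBodies

variable {E F : Type*} [AddCommGroup E] [Module ℝ E] [TopologicalSpace E]
  [AddCommGroup F] [Module ℝ F] [TopologicalSpace F]

/-- A convex body in a topological vector space which is symmetric about the origin; such a body
is a neighbourhood of the origin. -/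
structure IsSymmetricBody (K : Set E) : Prop where
  convex : Convex ℝ K
  isCompact : IsCompact K
  neg_mem : ∀ x ∈ K, -x ∈ K
  mem_nhds_zero : K ∈ nhds 0

lemma IsSymmetricBody.image {K : Set E} (hK : IsSymmetricBody K) (e : E ≃L[ℝ] F) :
    IsSymmetricBody (e '' K) where
  convex := hK.convex.linear_image (e : E →ₗ[ℝ] F)
  isCompact := hK.isCompact.image e.continuous
  neg_mem := by
    rintro _ ⟨x, hx, rfl⟩
    exact ⟨-x, hK.neg_mem x hx, map_neg e x⟩
  mem_nhds_zero := by
    simpa using e.toHomeomorph.isOpenMap.image_mem_nhds hK.mem_nhds_zero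

end SymmetricBodies

section Polarity

variable {n : ℕ}

/-- The polar of `K` with respect to the origin and the dot product. -/
def polar (K : Set (Fin n → ℝ)) : Set (Fin n → ℝ) := {y | ∀ x ∈ K, y ⬝ᵥ x ≤ 1}

lemma isClosed_polar (K : Set (Fin n → ℝ)) : IsClosed (polar K) := by
  simp only [polar, ofPred_forall]
  refine isClosed_biInter fun x _ ↦ isClosed_le ?_ continuous_const
  fun_prop

lemma convex_polar (K : Set (Fin n → ℝ)) : Convex ℝ (polar K) := by
  simp only [polar, ofPred_forall]
  exact convex_iInter₂ fun x _ ↦ convex_halfSpace_le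
    ⟨fun y z ↦ add_dotProduct y z x, fun c y ↦ smul_dotProduct c y x⟩ 1

lemma isCompact_polar {K : Set (Fin n → ℝ)} (hK : K ∈ nhds 0) : IsCompact (polar K) := by
  obtain ⟨r, hr, hrK⟩ := Metric.nhds_basis_closedBall.mem_iff.1 hK
  refine (isCompact_Icc (a := fun _ ↦ -r⁻¹) (b := fun _ ↦ r⁻¹)).of_isClosed_subset
    (isClosed_polar K) fun y hy ↦ ⟨fun i ↦ ?_, fun i ↦ ?_⟩
  · have h := hy (Pi.single i (-r)) (hrK (by simp [Pi.norm_single, abs_of_pos hr]))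
    rw [dotProduct_single] at h
    rw [neg_le, ← one_div, le_div_iff₀ hr]
    linarith
  · have h := hy (Pi.single i r) (hrK (by simp [Pi.norm_single, abs_of_pos hr]))
    rw [dotProduct_single] at h
    rwa [← one_div, le_div_iff₀ hr]

lemma IsSymmetricBody.coordSlice {K : Set (Fin (n + 1) → ℝ)} (hK : IsSymmetricBody K)
    (i : Fin (n + 1)) : IsSymmetricBody (coordSlice i K) := by
  have hcont : Continuous fun p : Fin n → ℝ ↦ (i.insertNth 0 p : Fin (n + 1) → ℝ) :=
    (continuous_insertNth i).comp (Continuous.prodMk_right 0)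
  have hsmul (c : ℝ) (p : Fin n → ℝ) :
      (i.insertNth 0 (c • p) : Fin (n + 1) → ℝ) = c • i.insertNth 0 p := by
    rw [← insertNth_smul, mul_zero]
  refine ⟨fun p hp q hq a b ha hb hab ↦ ?_, ?_, fun p hp ↦ ?_, ?_⟩
  · have h := hK.convex hp hq ha hb hab
    rwa [← hsmul, ← hsmul, ← Fin.insertNth_add, add_zero] at h
  · exact (isCompact_coordProj i hK.isCompact).of_isClosed_subset
      (hK.isCompact.isClosed.preimage hcont) fun p hp ↦ (mem_coordProj i).2 ⟨0, hp⟩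
  · have h := hK.neg_mem _ hp
    rwa [← neg_one_smul ℝ, ← hsmul, neg_one_smul] at h
  · refine hcont.continuousAt.preimage_mem_nhds ?_
    simpa using hK.mem_nhds_zero

lemma exists_linearMap_le_one_of_absorbent {E : Type*} [AddCommGroup E] [Module ℝ E] {K : Set E}
    (hK : Convex ℝ K) (habs : Absorbent ℝ K) {p : Submodule ℝ E} (f : p →ₗ[ℝ] ℝ)
    (hf : ∀ x : p, ↑x ∈ K → f x ≤ 1) :
    ∃ g : E →ₗ[ℝ] ℝ, (∀ x : p, g x = f x) ∧ ∀ x ∈ K, g x ≤ 1 := by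
  obtain ⟨g, hgf, hgK⟩ := exists_extension_of_le_sublinear ⟨p, f⟩ (gauge K)
    (fun c hc x ↦ gauge_smul_of_nonneg hc.le x) (gauge_add_le hK habs) fun x ↦ by
      refine le_of_forall_gt_imp_ge_of_dense fun a ha ↦ ?_
      obtain ⟨b, hb, hba, k, hk, hkx⟩ := exists_lt_of_gauge_lt habs ha
      have hk' : k = ↑(b⁻¹ • x) := by simp [← hkx, hb.ne']
      have h1 : f (b⁻¹ • x) ≤ 1 := hf _ (hk' ▸ hk)
      rw [map_smul, smul_eq_mul, inv_mul_le_iff₀ hb, mul_one] at h1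
      exact h1.trans hba.le
  exact ⟨g, hgf, fun x hx ↦ (hgK x).trans (gauge_le_one_of_mem hx)⟩

lemma IsSymmetricBody.polar_coordSlice_subset {K : Set (Fin (n + 1) → ℝ)} (hK : IsSymmetricBody K)
    (i : Fin (n + 1)) :
    polar (VolumeProduct.coordSlice i K) ⊆ coordProj i (polar K) := by
  intro p hp
  let T : (Fin (n + 1) → ℝ) →ₗ[ℝ] ℝ :=
    (dotProductBilin ℝ ℝ p).comp (LinearMap.funLeft ℝ ℝ i.succAbove)
  let H : Submodule ℝ (Fin (n + 1) → ℝ) := LinearMap.ker (LinearMap.proj i)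
  obtain ⟨g, hgT, hgK⟩ := exists_linearMap_le_one_of_absorbent hK.convex
    (absorbent_nhds_zero hK.mem_nhds_zero) (T.domRestrict H) fun x hx ↦ by
      refine hp _ ?_
      have hxi : x.1 i = 0 := x.2
      change i.insertNth 0 (i.removeNth x.1) ∈ K
      rwa [← hxi, Fin.insertNth_self_removeNth]
  obtain ⟨y, rfl⟩ := (dotProductEquiv ℝ (Fin (n + 1))).surjective g
  refine ⟨y, hgK, funext fun j ↦ ?_⟩
  have hj : Pi.single (i.succAbove j) 1 ∈ H := by simp [H]
  have hT : y ⬝ᵥ Pi.single (i.succAbove j) 1 =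
      p ⬝ᵥ fun k ↦ Pi.single (M := fun _ ↦ ℝ) (i.succAbove j) 1 (i.succAbove k) := hgT ⟨_, hj⟩
  simpa [dotProduct, Pi.single_apply, Fin.removeNth] using hT

end Polarity

section Equipartition

variable {n : ℕ}

lemma disjoint_orthant {ε δ : Fin n → ℤˣ} (h : ε ≠ δ) : Disjoint (orthant ε) (orthant δ) := by
  obtain ⟨i, hi⟩ := Function.ne_iff.1 h
  refine Set.disjoint_left.2 fun y hε hδ ↦ ?_
  have hneg : 0 < -(δ i • y i) := by
    rw [← Units.neg_smul, ← Int.units_ne_iff_eq_neg.1 hi]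
    exact hε i
  exact lt_asymm (hδ i) (neg_pos.1 hneg)

lemma exists_forall_nonneg_smul (x : Fin n → ℝ) : ∃ ε : Fin n → ℤˣ, ∀ i, 0 ≤ ε i • x i := by
  have (i : Fin n) : ∃ e : ℤˣ, 0 ≤ e • x i := by
    rcases le_total 0 (x i) with h | h
    · exact ⟨1, by simpa⟩
    · exact ⟨-1, by simpa⟩
  exact Classical.axiomOfChoice this

lemma ae_mem_iUnion_orthant : ∀ᵐ x : Fin n → ℝ, x ∈ ⋃ ε, orthant ε := by
  have hne : ∀ᵐ x : Fin n → ℝ, ∀ i, x i ≠ 0 :=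
    ae_all_iff.2 fun i ↦ compl_mem_ae_iff.2 (Measure.pi_hyperplane (fun _ ↦ volume) i 0)
  filter_upwards [hne] with x hx
  obtain ⟨ε, hε⟩ := exists_forall_nonneg_smul x
  exact mem_iUnion.2 ⟨ε, fun i ↦ (hε i).lt_of_ne' ((smul_ne_zero_iff_ne _).2 (hx i))⟩

lemma sum_volume_inter_orthant (S : Set (Fin n → ℝ)) :
    ∑ ε : Fin n → ℤˣ, volume (S ∩ orthant ε) = volume S := by
  have hmeas (ε : Fin n → ℤˣ) : MeasurableSet (orthant ε) := (isOpen_orthant ε).measurableSet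
  have hfull : volume.restrict S (⋃ ε, orthant ε)ᶜ = 0 := ae_restrict_of_ae ae_mem_iUnion_orthant
  rw [← Measure.restrict_apply_univ S, ← measure_add_measure_compl (MeasurableSet.iUnion hmeas),
    hfull, add_zero, measure_iUnion (fun _ _ ↦ disjoint_orthant) hmeas, tsum_fintype]
  exact Finset.sum_congr rfl fun ε _ ↦ by rw [Measure.restrict_apply (hmeas ε), inter_comm]

/-- The coordinate hyperplanes divide `S` into `2 ^ n` parts of equal volume. -/
def IsEquipartitioned (S : Set (Fin n → ℝ)) : Prop :=
  ∀ ε : Fin n → ℤˣ, 2 ^ n * volume.real (S ∩ orthant ε) = volume.real S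

/-- The product of the volumes of `K` and of its polar with respect to the origin. -/
noncomputable def mahlerVolume (K : Set (Fin n → ℝ)) : ℝ := volume.real K * volume.real (polar K)

variable {K : Set (Fin (n + 1) → ℝ)}

lemma sum_abs_mul_volume_coordSlice_le (hK : IsCompact K) (hconv : Convex ℝ K)
    (hpart : IsEquipartitioned K) (hslice : ∀ i, IsEquipartitioned (coordSlice i K))
    {x : Fin (n + 1) → ℝ} (hx : x ∈ K) :
    ∑ i, |x i| * (2 * volume.real (coordSlice i K)) ≤ (n + 1) * volume.real K := by
  obtain ⟨ε, hε⟩ := exists_forall_nonneg_smul x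
  calc ∑ i, |x i| * (2 * volume.real (coordSlice i K))
      = 2 ^ (n + 1) * ∑ i, |x i| * volume.real (coordSlice i K ∩ orthant (i.removeNth ε)) := by
        rw [Finset.mul_sum]
        refine Finset.sum_congr rfl fun i _ ↦ ?_
        rw [← hslice i (i.removeNth ε)]
        ring
    _ ≤ 2 ^ (n + 1) * ((n + 1) * volume.real (K ∩ orthant ε)) := by
        gcongr
        exact sum_mul_volume_coordSlice_inter_orthant_le hK hconv hx hε
    _ = (n + 1) * volume.real K := by
        rw [← hpart ε]
        ring

lemma Icc_subset_polar {c : Fin n → ℝ} {K : Set (Fin n → ℝ)} (h : ∀ x ∈ K, ∑ i, |x i| * c i ≤ 1) :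
    Icc (-c) c ⊆ polar K := fun y hy x hx ↦
  calc y ⬝ᵥ x ≤ ∑ i, |x i| * c i := Finset.sum_le_sum fun i _ ↦ by
        rw [mul_comm]
        refine (le_abs_self _).trans ?_
        rw [abs_mul]
        exact mul_le_mul_of_nonneg_left (abs_le.2 ⟨hy.1 i, hy.2 i⟩) (abs_nonneg _)
    _ ≤ 1 := h x hx

lemma IsSymmetricBody.sum_volume_coordSlice_mul_coordProj_polar_le (hK : IsSymmetricBody K)
    (hpart : IsEquipartitioned K) (hslice : ∀ i, IsEquipartitioned (VolumeProduct.coordSlice i K)) :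
    4 * ∑ i, volume.real (VolumeProduct.coordSlice i K) * volume.real (coordProj i (polar K)) ≤
      (n + 1) ^ 2 * mahlerVolume K := by
  set V := volume.real K
  have hVpos : 0 < V := ENNReal.toReal_pos (Measure.measure_pos_of_mem_nhds _ hK.mem_nhds_zero).ne'
    hK.isCompact.measure_lt_top.ne
  set c : Fin (n + 1) → ℝ := fun i ↦
    2 * volume.real (VolumeProduct.coordSlice i K) / ((n + 1) * V) with hc
  have hc_nonneg : 0 ≤ c := fun i ↦ by positivity
  have hbox : Icc (-c) c ⊆ polar K := Icc_subset_polar fun x hx ↦ by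
    simp only [hc, ← mul_div_assoc]
    rw [← Finset.sum_div, div_le_one (by positivity)]
    exact sum_abs_mul_volume_coordSlice_le hK.isCompact hK.convex hpart hslice hx
  have hmixed := sum_mul_volume_coordProj_le (isCompact_polar hK.mem_nhds_zero) (convex_polar K)
    hc_nonneg hbox
  calc 4 * ∑ i, volume.real (VolumeProduct.coordSlice i K) * volume.real (coordProj i (polar K))
      = (n + 1) * V * ∑ i, 2 * c i * volume.real (coordProj i (polar K)) := by
        rw [Finset.mul_sum, Finset.mul_sum]
        refine Finset.sum_congr rfl fun i _ ↦ ?_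
        simp only [hc]
        field_simp
        ring
    _ ≤ (n + 1) * V * ((n + 1) * volume.real (polar K)) := by gcongr
    _ = (n + 1) ^ 2 * mahlerVolume K := by
        rw [mahlerVolume]
        ring

theorem IsSymmetricBody.four_mul_le_mahlerVolume (hK : IsSymmetricBody K) {m : ℝ}
    (hm : ∀ S : Set (Fin n → ℝ), IsSymmetricBody S → m ≤ mahlerVolume S)
    (hpart : IsEquipartitioned K)
    (hslice : ∀ i, IsEquipartitioned (VolumeProduct.coordSlice i K)) :
    4 * m ≤ (n + 1) * mahlerVolume K := by
  have hsum : (n + 1) * m ≤ ∑ i, volume.real (VolumeProduct.coordSlice i K) *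
      volume.real (coordProj i (polar K)) := by
    calc (n + 1) * m = ∑ _i : Fin (n + 1), m := by simp
      _ ≤ _ := Finset.sum_le_sum fun i _ ↦ (hm _ (hK.coordSlice i)).trans <| by
        refine mul_le_mul_of_nonneg_left (measureReal_mono (hK.polar_coordSlice_subset i) ?_)
          measureReal_nonneg
        exact (isCompact_coordProj i (isCompact_polar hK.mem_nhds_zero)).measure_lt_top.ne
  have hmixed := hK.sum_volume_coordSlice_mul_coordProj_polar_le hpart hslice
  refine le_of_mul_le_mul_left (a := (n + 1 : ℝ)) ?_ (by positivity)
  linarith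

end Equipartition

section SignChanges

variable {n : ℕ} {K : Set (Fin n → ℝ)}

lemma measurePreserving_signs_smul (ε : Fin n → ℤˣ) :
    MeasurePreserving (fun x : Fin n → ℝ ↦ ε • x) volume volume := by
  refine volume_preserving_pi (f := fun i (t : ℝ) ↦ ε i • t) fun i ↦ ?_
  rcases Int.units_eq_one_or (ε i) with h | h
  · simp only [h, one_smul]
    exact MeasurePreserving.id volume
  · simpa [h, Units.neg_smul] using Measure.measurePreserving_neg volume

lemma signs_smul_smul (ε : Fin n → ℤˣ) (x : Fin n → ℝ) : ε • ε • x = x := by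
  ext i
  simp [smul_smul]

lemma volume_real_inter_orthant_mul (hK : MeasurableSet K) {ε : Fin n → ℤˣ}
    (hε : ∀ x ∈ K, ε • x ∈ K) (δ : Fin n → ℤˣ) :
    volume.real (K ∩ orthant (ε * δ)) = volume.real (K ∩ orthant δ) := by
  have hpre : (fun x : Fin n → ℝ ↦ ε • x) ⁻¹' (K ∩ orthant δ) = K ∩ orthant (ε * δ) := by
    ext x
    have hmem : ε • x ∈ K ↔ x ∈ K := ⟨fun h ↦ by simpa [signs_smul_smul] using hε _ h, hε x⟩
    simp [orthant, hmem, smul_smul, mul_comm]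
  rw [← hpre, measureReal_def, (measurePreserving_signs_smul ε).measure_preimage
    (hK.inter (isOpen_orthant δ).measurableSet).nullMeasurableSet, measureReal_def]

lemma isEquipartitioned_of_forall_signs_smul_mem (hK : MeasurableSet K) (hfin : volume K ≠ ⊤)
    (h : ∀ ε : Fin n → ℤˣ, ∀ x ∈ K, ε • x ∈ K) : IsEquipartitioned K := by
  intro ε
  have hterm (δ : Fin n → ℤˣ) : volume.real (K ∩ orthant δ) = volume.real (K ∩ orthant ε) := by
    have hεε : ε * ε = 1 := funext fun i ↦ Int.units_mul_self (ε i)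
    rw [← volume_real_inter_orthant_mul hK (h (δ * ε)) ε, mul_assoc, hεε, mul_one]
  have hfin' (δ : Fin n → ℤˣ) : volume (K ∩ orthant δ) ≠ ⊤ := measure_ne_top_of_subset
    inter_subset_left hfin
  conv_rhs => rw [measureReal_def, ← sum_volume_inter_orthant K,
    ENNReal.toReal_sum fun δ _ ↦ hfin' δ]
  simp only [← measureReal_def, hterm]
  simp

lemma two_mul_volume_real_inter_orthant_of_reflection {i : Fin (n + 1)} {K : Set (Fin (n + 1) → ℝ)}
    (hK : MeasurableSet K) (hfin : volume K ≠ ⊤)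
    (hflip : ∀ x ∈ K, (Pi.mulSingle i (-1) : Fin (n + 1) → ℤˣ) • x ∈ K)
    (ε : Fin (n + 1) → ℤˣ) :
    2 * volume.real (K ∩ orthant ε) =
      volume.real (K ∩ i.removeNth ⁻¹' orthant (i.removeNth ε)) := by
  set δ : Fin (n + 1) → ℤˣ := Pi.mulSingle i (-1) * ε
  have hδ : δ i = -ε i ∧ ∀ j, δ (i.succAbove j) = ε (i.succAbove j) := by simp [δ]
  have hne : ε ≠ δ := fun h ↦ units_ne_neg_self (ε i) ((congrFun h i).trans hδ.1)
  have hunion : (K ∩ i.removeNth ⁻¹' orthant (i.removeNth ε) : Set (Fin (n + 1) → ℝ)) =ᵐ[volume]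
      (K ∩ orthant ε ∪ K ∩ orthant δ : Set (Fin (n + 1) → ℝ)) := by
    rw [← inter_union_distrib_left]
    refine Filter.EventuallyEq.rfl.inter ?_
    filter_upwards [compl_mem_ae_iff.2 (Measure.pi_hyperplane (fun _ ↦ volume) i 0)] with x hx
    have hsign : 0 < ε i • x i ∨ ε i • x i < 0 :=
      ((smul_ne_zero_iff_ne (ε i)).2 hx).lt_or_gt.symm
    refine propext ?_
    change (∀ j, 0 < ε (i.succAbove j) • x (i.succAbove j)) ↔ (∀ j, _) ∨ ∀ j, _
    simp only [Fin.forall_iff_succAbove i, hδ.1, hδ.2, Units.neg_smul, neg_pos, ← or_and_right]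
    exact (and_iff_right hsign).symm
  have hfin' (δ : Fin (n + 1) → ℤˣ) : volume (K ∩ orthant δ) ≠ ⊤ :=
    measure_ne_top_of_subset inter_subset_left hfin
  rw [measureReal_congr hunion, measureReal_union
    ((disjoint_orthant hne).mono inter_subset_right inter_subset_right)
    (hK.inter (isOpen_orthant δ).measurableSet) (hfin' ε) (hfin' δ),
    volume_real_inter_orthant_mul hK hflip, two_mul]

end SignChanges

section LinearInvariance

variable {n : ℕ} {K : Set (Fin n → ℝ)} (e : (Fin n → ℝ) ≃L[ℝ] (Fin n → ℝ))

lemma volume_real_image (S : Set (Fin n → ℝ)) :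
    volume.real (e '' S) = |LinearMap.det (e : (Fin n → ℝ) →ₗ[ℝ] (Fin n → ℝ))| * volume.real S := by
  have h := Measure.addHaar_image_continuousLinearEquiv volume e S
  rw [measureReal_def, h, ENNReal.toReal_mul, ENNReal.toReal_ofReal (abs_nonneg _), measureReal_def]

theorem mahlerVolume_image : mahlerVolume (e '' K) = mahlerVolume K := by
  set f := (e : (Fin n → ℝ) →ₗ[ℝ] (Fin n → ℝ))
  have hdet : LinearMap.det f ≠ 0 := (LinearEquiv.isUnit_det' e.toLinearEquiv).ne_zero
  set g := (LinearMap.toMatrix' f).transpose.toLin'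
  have hg : LinearMap.det g = LinearMap.det f := by
    rw [LinearMap.det_toLin', Matrix.det_transpose, LinearMap.det_toMatrix']
  have hpolar : polar (e '' K) = g ⁻¹' polar K := by
    ext y
    refine forall_mem_image.trans (forall₂_congr fun x _ ↦ ?_)
    rw [Matrix.toLin'_apply, Matrix.mulVec_transpose, ← Matrix.dotProduct_mulVec,
      LinearMap.toMatrix'_mulVec]
    rfl
  have hvol : volume.real (g ⁻¹' polar K) = |(LinearMap.det f)⁻¹| * volume.real (polar K) := by
    rw [measureReal_def, Measure.addHaar_preimage_linearMap _ (hg ▸ hdet), hg, ENNReal.toReal_mul,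
      ENNReal.toReal_ofReal (abs_nonneg _), measureReal_def]
  have himage : volume.real (e '' K) = |LinearMap.det f| * volume.real K := volume_real_image e K
  rw [mahlerVolume, mahlerVolume, hpolar, hvol, himage, abs_inv]
  field_simp

lemma isEquipartitioned_image
    (h : ∀ ε, 2 ^ n * volume.real (K ∩ e ⁻¹' orthant ε) = volume.real K) :
    IsEquipartitioned (e '' K) := by
  intro ε
  rw [← image_inter_preimage, volume_real_image, volume_real_image, mul_left_comm, h]

end LinearInvariance

section AntiperiodicZeros

variable {T : ℝ} {f : ℝ → ℝ → ℝ}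

lemma continuous_of_strictAntiOn_of_eq_zero (hf : ∀ b, Continuous fun a ↦ f a b)
    (hanti : ∀ a, StrictAntiOn (f a) (Ioo a (a + T))) {φ : ℝ → ℝ}
    (hφ : ∀ a, φ a ∈ Ioo a (a + T)) (hzero : ∀ a, f a (φ a) = 0) : Continuous φ := by
  refine continuous_iff_continuousAt.2 fun a ↦ tendsto_order.2 ⟨fun c hc ↦ ?_, fun c hc ↦ ?_⟩
  · obtain ⟨c', hc', hc'φ⟩ := exists_between (max_lt hc (hφ a).1)
    rw [max_lt_iff] at hc'
    have hmem : c' ∈ Ioo a (a + T) := ⟨hc'.2, hc'φ.trans (hφ a).2⟩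
    have hpos : 0 < f a c' := hzero a ▸ hanti a hmem (hφ a) hc'φ
    filter_upwards [(hf c').continuousAt.eventually_const_lt hpos, eventually_lt_nhds hmem.1,
      eventually_gt_nhds (sub_lt_iff_lt_add.2 hmem.2)] with b hb hbc hcb
    refine hc'.1.trans (lt_of_not_ge fun hle ↦ hb.not_ge ?_)
    exact hzero b ▸ (hanti b).antitoneOn (hφ b) ⟨hbc, sub_lt_iff_lt_add.1 hcb⟩ hle
  · obtain ⟨c', hφc', hc'⟩ := exists_between (lt_min hc (hφ a).2)
    rw [lt_min_iff] at hc'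
    have hmem : c' ∈ Ioo a (a + T) := ⟨(hφ a).1.trans hφc', hc'.2⟩
    have hneg : f a c' < 0 := hzero a ▸ hanti a (hφ a) hmem hφc'
    filter_upwards [(hf c').continuousAt.eventually_lt_const hneg, eventually_lt_nhds hmem.1,
      eventually_gt_nhds (sub_lt_iff_lt_add.2 hmem.2)] with b hb hbc hcb
    refine lt_of_not_ge fun hle ↦ hb.not_ge ?_
    exact hzero b ▸ (hanti b).antitoneOn ⟨hbc, sub_lt_iff_lt_add.1 hcb⟩ (hφ b) (hc'.1.le.trans hle)

lemma exists_common_zero_of_antiperiodic {g : ℝ → ℝ → ℝ} (hT : 0 < T)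
    (hf : ∀ b, Continuous fun a ↦ f a b) (hg : Continuous (Function.uncurry g))
    (hf_comm : ∀ a b, f a b = f b a) (hg_comm : ∀ a b, g a b = g b a)
    (hf_add : ∀ a b, f a (b + T) = -f a b) (hg_add : ∀ a b, g a (b + T) = -g a b)
    (hpos : ∀ a, 0 < f a a) (hanti : ∀ a, StrictAntiOn (f a) (Ioo a (a + T))) :
    ∃ a, ∃ b ∈ Ioo a (a + T), f a b = 0 ∧ g a b = 0 := by
  have hex (a : ℝ) : ∃ b ∈ Ioo a (a + T), f a b = 0 := by
    have hcont : Continuous (f a) := (hf a).congr (hf_comm · a)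
    refine intermediate_value_Ioo' (le_add_of_nonneg_right hT.le) hcont.continuousOn ⟨?_, hpos a⟩
    rw [hf_add]
    exact neg_neg_of_pos (hpos a)
  choose φ hφ hzero using hex
  have hφ_cont : Continuous φ := continuous_of_strictAntiOn_of_eq_zero hf hanti hφ hzero
  have hφφ (a : ℝ) : φ (φ a) = a + T := by
    refine (hanti (φ a)).injOn (hφ _) ⟨(hφ a).2, add_lt_add_left (hφ a).1 T⟩ ?_
    rw [hzero, hf_add, hf_comm, hzero, neg_zero]
  have hg_odd (a : ℝ) : g (φ a) (φ (φ a)) = -g a (φ a) := by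
    rw [hφφ, hg_add, hg_comm]
  have hg_cont : Continuous fun a ↦ g a (φ a) := hg.comp (continuous_id.prodMk hφ_cont)
  obtain ⟨a, ha⟩ : (0 : ℝ) ∈ range fun a ↦ g a (φ a) := by
    rcases le_total (g 0 (φ 0)) 0 with h | h
    · exact mem_range_of_exists_le_of_exists_ge hg_cont ⟨0, h⟩
        ⟨φ 0, (neg_nonneg.2 h).trans_eq (hg_odd 0).symm⟩
    · exact mem_range_of_exists_le_of_exists_ge hg_cont
        ⟨φ 0, (hg_odd 0).trans_le (neg_nonpos.2 h)⟩ ⟨0, h⟩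
  exact ⟨a, φ a, hφ a, hzero a, ha⟩

end AntiperiodicZeros

section Wedges

variable {n : ℕ}

/-- The intersection of the open half-spaces with inner normals `u` and `v`. -/
def wedge (u v : Fin n → ℝ) : Set (Fin n → ℝ) := {p | 0 < u ⬝ᵥ p ∧ 0 < v ⬝ᵥ p}

lemma isOpen_wedge (u v : Fin n → ℝ) : IsOpen (wedge u v) := by
  have hcont (w : Fin n → ℝ) : Continuous fun p : Fin n → ℝ ↦ w ⬝ᵥ p := by fun_prop
  exact (isOpen_lt continuous_const (hcont u)).inter (isOpen_lt continuous_const (hcont v))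

lemma wedge_comm (u v : Fin n → ℝ) : wedge u v = wedge v u := by
  simp only [wedge, and_comm]

lemma disjoint_wedge_neg (u v w : Fin n → ℝ) : Disjoint (wedge u v) (wedge w (-v)) :=
  Set.disjoint_left.2 fun p hp hp' ↦
    lt_asymm hp.2 (by simpa only [neg_dotProduct, neg_pos] using hp'.2)

variable {μ : Measure (Fin n → ℝ)}

lemma ae_dotProduct_ne_zero (hμ : μ ≪ volume) {u : Fin n → ℝ} (hu : u ≠ 0) :
    ∀ᵐ p ∂μ, u ⬝ᵥ p ≠ 0 := by
  refine hμ.ae_le (compl_mem_ae_iff.2 (Measure.addHaar_submodule volume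
    (LinearMap.ker (dotProductBilin ℝ ℝ u)) fun h ↦ hu (dotProduct_self_eq_zero.1 ?_)))
  exact (h ▸ Submodule.mem_top : u ∈ LinearMap.ker (dotProductBilin ℝ ℝ u))

lemma measureReal_wedge_neg_neg [μ.IsNegInvariant] (u v : Fin n → ℝ) :
    μ.real (wedge (-u) (-v)) = μ.real (wedge u v) := by
  have h : wedge (-u) (-v) = -wedge u v := by
    ext p
    simp [wedge]
  rw [h, measureReal_def, Measure.measure_neg, measureReal_def]

variable [IsFiniteMeasure μ]

lemma continuous_measureReal_wedge (hμ : μ ≪ volume) {X : Type*} [TopologicalSpace X]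
    [FirstCountableTopology X] {u v : X → Fin n → ℝ} (hu : Continuous u) (hv : Continuous v)
    (hu0 : ∀ x, u x ≠ 0) (hv0 : ∀ x, v x ≠ 0) :
    Continuous fun x ↦ μ.real (wedge (u x) (v x)) := by
  refine continuous_iff_continuousAt.2 fun x ↦ ?_
  refine (ENNReal.tendsto_toReal (measure_ne_top μ _)).comp
    (tendsto_measure_of_ae_tendsto_indicator_of_isFiniteMeasure (nhds x)
      (isOpen_wedge _ _).measurableSet (fun y ↦ (isOpen_wedge _ _).measurableSet) ?_)
  filter_upwards [ae_dotProduct_ne_zero hμ (hu0 x), ae_dotProduct_ne_zero hμ (hv0 x)] with p hup hvp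
  have hsign {w : X → Fin n → ℝ} (hw : Continuous w) (hp : w x ⬝ᵥ p ≠ 0) :
      ∀ᶠ y in nhds x, 0 < w y ⬝ᵥ p ↔ 0 < w x ⬝ᵥ p := by
    have hcont : ContinuousAt (fun y ↦ w y ⬝ᵥ p) x := by fun_prop
    rcases hp.lt_or_gt with h | h
    · filter_upwards [hcont.eventually_lt_const h] with y hy
      simp only [hy.not_gt, h.not_gt]
    · filter_upwards [hcont.eventually_const_lt h] with y hy
      simp only [hy, h]
  filter_upwards [hsign hu hup, hsign hv hvp] with y hy hy'
  exact and_congr hy hy'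

lemma measureReal_wedge_add_wedge_neg (hμ : μ ≪ volume) (u : Fin n → ℝ) {v : Fin n → ℝ}
    (hv : v ≠ 0) : μ.real (wedge u v) + μ.real (wedge u (-v)) = μ.real (wedge u u) := by
  rw [← measureReal_union (disjoint_wedge_neg u v u) (isOpen_wedge _ _).measurableSet]
  refine measureReal_congr ?_
  filter_upwards [ae_dotProduct_ne_zero hμ hv] with p hp
  have hsign : 0 < v ⬝ᵥ p ∨ 0 < -v ⬝ᵥ p := by simpa using hp.lt_or_gt.symm
  refine propext (and_or_left.symm.trans ?_)
  rw [and_iff_left hsign]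
  exact (and_self_iff).symm

lemma two_mul_measureReal_wedge_self [μ.IsNegInvariant] (hμ : μ ≪ volume) {u : Fin n → ℝ}
    (hu : u ≠ 0) : 2 * μ.real (wedge u u) = μ.real univ := by
  have hcover : (wedge u u ∪ wedge (-u) (-u) : Set (Fin n → ℝ)) =ᵐ[μ] univ := by
    filter_upwards [ae_dotProduct_ne_zero hμ hu] with p hp
    have hsign : 0 < u ⬝ᵥ p ∨ 0 < -u ⬝ᵥ p := by simpa using hp.lt_or_gt.symm
    exact eq_true (hsign.imp (fun h ↦ ⟨h, h⟩) fun h ↦ ⟨h, h⟩)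
  rw [← measureReal_congr hcover, measureReal_union (disjoint_wedge_neg u u (-u))
    (isOpen_wedge _ _).measurableSet, measureReal_wedge_neg_neg, two_mul]

lemma four_mul_measureReal_wedge_units_smul [μ.IsNegInvariant] (hμ : μ ≪ volume)
    {u v : Fin n → ℝ} (hu : u ≠ 0) (hv : v ≠ 0) (h : 4 * μ.real (wedge u v) = μ.real univ)
    (ε δ : ℤˣ) : 4 * μ.real (wedge (ε • u) (δ • v)) = μ.real univ := by
  have hneg : 4 * μ.real (wedge u (-v)) = μ.real univ := by
    linarith [measureReal_wedge_add_wedge_neg hμ u hv, two_mul_measureReal_wedge_self hμ hu]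
  rcases Int.units_eq_one_or ε with rfl | rfl <;> rcases Int.units_eq_one_or δ with rfl | rfl <;>
    simp only [one_smul, Units.neg_smul]
  · exact h
  · exact hneg
  · rwa [← measureReal_wedge_neg_neg, neg_neg]
  · rwa [measureReal_wedge_neg_neg]

end Wedges

section PlaneEquipartition

open Real

/-- The unit vector of the plane with polar angle `θ`. -/
noncomputable def direction (θ : ℝ) : Fin 2 → ℝ := ![cos θ, sin θ]

lemma continuous_direction : Continuous direction := by
  unfold direction
  fun_prop

lemma direction_dotProduct (a b : ℝ) : direction a ⬝ᵥ direction b = cos (a - b) := by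
  simp [direction, cos_sub]

lemma direction_ne_zero (θ : ℝ) : direction θ ≠ 0 := by
  rw [Ne, ← dotProduct_self_eq_zero, direction_dotProduct, sub_self, cos_zero]
  exact one_ne_zero

lemma direction_add_pi (θ : ℝ) : direction (θ + π) = -direction θ := by
  simp [direction]

lemma sin_sub_smul_direction (a b c : ℝ) :
    sin (c - a) • direction b = sin (c - b) • direction a + sin (b - a) • direction c := by
  ext i
  fin_cases i <;> simp [direction, sin_sub] <;> ring

lemma wedge_direction_union_subset {a b c : ℝ} (hab : a < b) (hbc : b < c) (hca : c < a + π) :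
    wedge (direction a) (direction c) ∪ wedge (direction b) (-direction c) ⊆
      wedge (direction a) (direction b) := by
  have hsin {x y : ℝ} (hax : a ≤ x) (hxy : x < y) (hyc : y ≤ c) : 0 < sin (y - x) :=
    sin_pos_of_pos_of_lt_pi (by linarith) (by linarith)
  have hba := hsin le_rfl hab hbc.le
  have hcb := hsin hab.le hbc le_rfl
  have hca := hsin le_rfl (hab.trans hbc) le_rfl
  have hrel (p : Fin 2 → ℝ) : sin (c - a) * (direction b ⬝ᵥ p) =
      sin (c - b) * (direction a ⬝ᵥ p) + sin (b - a) * (direction c ⬝ᵥ p) := by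
    simpa only [add_dotProduct, smul_dotProduct, smul_eq_mul] using
      congrArg (· ⬝ᵥ p) (sin_sub_smul_direction a b c)
  rintro p (⟨hpa, hpc⟩ | ⟨hpb, hpc⟩)
  · refine ⟨hpa, pos_of_mul_pos_right ?_ hca.le⟩
    rw [hrel]
    positivity
  · rw [neg_dotProduct, neg_pos] at hpc
    refine ⟨pos_of_mul_pos_right ?_ hcb.le, hpb⟩
    rw [← sub_eq_of_eq_add (hrel p)]
    nlinarith

lemma nonempty_wedge_direction_neg {b c : ℝ} (hbc : b < c) (hcb : c < b + π) :
    (wedge (direction b) (-direction c)).Nonempty := by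
  have hcos : cos (c - b) < 1 := by
    rw [← cos_zero]
    exact cos_lt_cos_of_nonneg_of_le_pi le_rfl (by linarith) (by linarith)
  refine ⟨direction b - direction c, ?_, ?_⟩
  · rw [dotProduct_sub, direction_dotProduct, direction_dotProduct, sub_self, cos_zero,
      ← cos_neg, neg_sub]
    exact sub_pos.2 hcos
  · rw [neg_dotProduct, dotProduct_sub, direction_dotProduct, direction_dotProduct, sub_self,
      cos_zero, neg_sub]
    exact sub_pos.2 hcos

variable {μ ν : Measure (Fin 2 → ℝ)} [IsFiniteMeasure μ] [IsFiniteMeasure ν]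

lemma strictAntiOn_measureReal_wedge_direction
    (hpos : ∀ u v, (wedge u v).Nonempty → 0 < μ (wedge u v)) (a : ℝ) :
    StrictAntiOn (fun b ↦ μ.real (wedge (direction a) (direction b))) (Ioo a (a + π)) := by
  intro b hb c hc hbc
  have hgap : 0 < μ.real (wedge (direction b) (-direction c)) :=
    ENNReal.toReal_pos (hpos _ _ (nonempty_wedge_direction_neg hbc (by linarith [hb.1, hc.2]))).ne'
      (measure_ne_top μ _)
  calc μ.real (wedge (direction a) (direction c))
      < μ.real (wedge (direction a) (direction c)) +
          μ.real (wedge (direction b) (-direction c)) := lt_add_of_pos_right _ hgap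
    _ = μ.real (wedge (direction a) (direction c) ∪ wedge (direction b) (-direction c)) :=
        (measureReal_union (disjoint_wedge_neg _ _ _) (isOpen_wedge _ _).measurableSet).symm
    _ ≤ μ.real (wedge (direction a) (direction b)) :=
        measureReal_mono (wedge_direction_union_subset hb.1 hbc hc.2)

/-- The excess over a quarter of the total mass of the wedge with inner normals `direction a` and
`direction b`. -/
noncomputable def wedgeExcess (μ : Measure (Fin 2 → ℝ)) (a b : ℝ) : ℝ :=
  μ.real (wedge (direction a) (direction b)) - μ.real univ / 4

lemma wedgeExcess_comm (μ : Measure (Fin 2 → ℝ)) (a b : ℝ) :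
    wedgeExcess μ a b = wedgeExcess μ b a := by
  rw [wedgeExcess, wedge_comm, wedgeExcess]

lemma continuous_wedgeExcess (hμ : μ ≪ volume) :
    Continuous (Function.uncurry (wedgeExcess μ)) :=
  (continuous_measureReal_wedge hμ (continuous_direction.comp continuous_fst)
    (continuous_direction.comp continuous_snd) (fun x ↦ direction_ne_zero x.1)
    fun x ↦ direction_ne_zero x.2).sub continuous_const

lemma wedgeExcess_self [μ.IsNegInvariant] (hμ : μ ≪ volume) (a : ℝ) :
    wedgeExcess μ a a = μ.real univ / 4 := by
  rw [wedgeExcess]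
  linarith [two_mul_measureReal_wedge_self hμ (direction_ne_zero a)]

lemma wedgeExcess_add_pi [μ.IsNegInvariant] (hμ : μ ≪ volume) (a b : ℝ) :
    wedgeExcess μ a (b + π) = -wedgeExcess μ a b := by
  rw [wedgeExcess, wedgeExcess, direction_add_pi]
  linarith [measureReal_wedge_add_wedge_neg hμ (direction a) (direction_ne_zero b),
    two_mul_measureReal_wedge_self hμ (direction_ne_zero a)]

-- Rotate a line through the origin; the unique second line that quarters `μ` together with it moves
-- continuously, and exchanging the two lines changes the sign of the excess of `ν`.
lemma exists_wedgeExcess_eq_zero [μ.IsNegInvariant] [ν.IsNegInvariant]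
    (hμ : μ ≪ volume) (hν : ν ≪ volume)
    (hpos : ∀ u v, (wedge u v).Nonempty → 0 < μ (wedge u v)) :
    ∃ a, ∃ b ∈ Ioo a (a + π), wedgeExcess μ a b = 0 ∧ wedgeExcess ν a b = 0 := by
  have hdir : 0 < direction 0 ⬝ᵥ direction 0 := by
    rw [direction_dotProduct, sub_self, cos_zero]
    exact one_pos
  have hne : (wedge (direction 0) (direction 0)).Nonempty := ⟨direction 0, hdir, hdir⟩
  have huniv : 0 < μ.real univ :=
    (ENNReal.toReal_pos (hpos _ _ hne).ne' (measure_ne_top μ _)).trans_le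
      (measureReal_mono (subset_univ _))
  have hself (a : ℝ) : 0 < wedgeExcess μ a a := by
    rw [wedgeExcess_self hμ]
    positivity
  have hanti (a : ℝ) : StrictAntiOn (wedgeExcess μ a) (Ioo a (a + π)) := fun b hb c hc hbc ↦
    sub_lt_sub_right (strictAntiOn_measureReal_wedge_direction hpos a hb hc hbc) _
  exact exists_common_zero_of_antiperiodic pi_pos
    (fun b ↦ (continuous_wedgeExcess hμ).uncurry_right b) (continuous_wedgeExcess hν)
    (wedgeExcess_comm μ) (wedgeExcess_comm ν) (wedgeExcess_add_pi hμ) (wedgeExcess_add_pi hν)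
    hself hanti

lemma exists_continuousLinearEquiv_direction {a b : ℝ} (hb : b ∈ Ioo a (a + π)) :
    ∃ e : (Fin 2 → ℝ) ≃L[ℝ] (Fin 2 → ℝ), ∀ p, e p = ![direction a ⬝ᵥ p, direction b ⬝ᵥ p] := by
  have hdet : LinearMap.det (Matrix.of ![direction a, direction b]).toLin' ≠ 0 := by
    have hsin : 0 < sin (b - a) :=
      sin_pos_of_pos_of_lt_pi (sub_pos.2 hb.1) (sub_lt_iff_lt_add'.2 hb.2)
    rw [LinearMap.det_toLin', Matrix.det_fin_two]
    rw [sin_sub] at hsin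
    simpa [direction, mul_comm] using hsin.ne'
  refine ⟨(LinearMap.equivOfDetNeZero _ hdet).toContinuousLinearEquiv, fun p ↦ ?_⟩
  ext i
  fin_cases i <;> rfl

theorem exists_equipartition [μ.IsNegInvariant] [ν.IsNegInvariant] (hμ : μ ≪ volume)
    (hν : ν ≪ volume) (hpos : ∀ u v, (wedge u v).Nonempty → 0 < μ (wedge u v)) :
    ∃ e : (Fin 2 → ℝ) ≃L[ℝ] (Fin 2 → ℝ), ∀ ε : Fin 2 → ℤˣ,
      4 * μ.real (e ⁻¹' orthant ε) = μ.real univ ∧ 4 * ν.real (e ⁻¹' orthant ε) = ν.real univ := by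
  obtain ⟨a, b, hb, hμab, hνab⟩ := exists_wedgeExcess_eq_zero hμ hν hpos
  obtain ⟨e, he⟩ := exists_continuousLinearEquiv_direction hb
  refine ⟨e, fun ε ↦ ?_⟩
  have hpre : e ⁻¹' orthant ε = wedge (ε 0 • direction a) (ε 1 • direction b) := by
    ext p
    simp [orthant, wedge, he]
  have hquarter {ρ : Measure (Fin 2 → ℝ)} [IsFiniteMeasure ρ] [ρ.IsNegInvariant] (hρ : ρ ≪ volume)
      (h : wedgeExcess ρ a b = 0) : 4 * ρ.real (e ⁻¹' orthant ε) = ρ.real univ := by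
    rw [wedgeExcess] at h
    rw [hpre]
    exact four_mul_measureReal_wedge_units_smul hρ (direction_ne_zero a) (direction_ne_zero b)
      (by linarith) _ _
  exact ⟨hquarter hμ hμab, hquarter hν hνab⟩

end PlaneEquipartition

section EvenMeasures

variable {E F : Type*} [MeasurableSpace E] [AddGroup E] [MeasurableNeg E]
  [MeasurableSpace F] [AddGroup F] [MeasurableNeg F] {μ : Measure E} [μ.IsNegInvariant]

lemma isNegInvariant_restrict {K : Set E} (hK : MeasurableSet K) (hneg : ∀ x ∈ K, -x ∈ K) :
    (μ.restrict K).IsNegInvariant where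
  neg_eq_self := by
    have hpre : Neg.neg ⁻¹' K = K :=
      Subset.antisymm (fun x hx ↦ neg_neg x ▸ hneg _ hx) fun x hx ↦ hneg x hx
    have h := ((Measure.measurePreserving_neg μ).restrict_preimage hK).map_eq
    rwa [hpre] at h

lemma isNegInvariant_map {f : E → F} (hf : Measurable f) (hneg : ∀ x, f (-x) = -f x) :
    (μ.map f).IsNegInvariant where
  neg_eq_self := by
    have hcomm : Neg.neg ∘ f = f ∘ Neg.neg := funext fun x ↦ (hneg x).symm
    rw [Measure.neg, Measure.map_map measurable_neg hf, hcomm, ← Measure.map_map hf measurable_neg,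
      Measure.map_neg_eq_self]

lemma measure_le_setLIntegral_of_two_le {S : Set E} (hS : MeasurableSet S)
    (hneg : ∀ y ∈ S, -y ∈ S) {φ : E → ℝ≥0∞} (hφ : Measurable φ)
    (htwo : ∀ y ∈ S, 2 ≤ φ y + φ (-y)) : μ S ≤ ∫⁻ y in S, φ y ∂μ := by
  have := isNegInvariant_restrict (μ := μ) hS hneg
  refine (ENNReal.mul_le_mul_iff_right two_ne_zero ENNReal.ofNat_ne_top).1 ?_
  calc 2 * μ S = ∫⁻ _ in S, 2 ∂μ := (setLIntegral_const S 2).symm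
    _ ≤ ∫⁻ y in S, φ y + φ (-y) ∂μ := setLIntegral_mono' hS htwo
    _ = 2 * ∫⁻ y in S, φ y ∂μ := by
        rw [lintegral_add_left hφ, lintegral_neg_eq_self, two_mul]

end EvenMeasures

lemma measure_inter_pos_of_cone {E : Type*} [AddCommGroup E] [Module ℝ E] [TopologicalSpace E]
    [ContinuousSMul ℝ E] [MeasurableSpace E] (μ : Measure E) [μ.IsOpenPosMeasure] {K C : Set E}
    (hK : K ∈ nhds 0) (hC : IsOpen C) (hne : C.Nonempty)
    (hsmul : ∀ t : ℝ, 0 < t → ∀ x ∈ C, t • x ∈ C) : 0 < μ (K ∩ C) := by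
  obtain ⟨x, hx⟩ := hne
  have htend : Filter.Tendsto (fun t : ℝ ↦ t • x) (nhdsWithin 0 (Ioi 0)) (nhds 0) := by
    have h : ContinuousAt (fun t : ℝ ↦ t • x) 0 := by fun_prop
    simpa using h.tendsto.mono_left nhdsWithin_le_nhds
  obtain ⟨t, htK, ht⟩ :=
    ((htend.eventually_mem (interior_mem_nhds.2 hK)).and self_mem_nhdsWithin).exists
  exact ((isOpen_interior.inter hC).measure_pos μ ⟨t • x, htK, hsmul t ht x hx⟩).trans_le
    (measure_mono (inter_subset_inter_left C interior_subset))

section LowDimensions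

lemma smul_mem_wedge {n : ℕ} {u v p : Fin n → ℝ} {t : ℝ} (ht : 0 < t) (hp : p ∈ wedge u v) :
    t • p ∈ wedge u v := by
  simpa only [wedge, mem_ofPred_eq, dotProduct_smul, smul_eq_mul, mul_pos_iff_of_pos_left ht]
    using hp

lemma IsSymmetricBody.measurableSet {n : ℕ} {K : Set (Fin n → ℝ)} (hK : IsSymmetricBody K) :
    MeasurableSet K :=
  hK.isCompact.isClosed.measurableSet

lemma IsSymmetricBody.one_le_mahlerVolume {K : Set (Fin 0 → ℝ)} (hK : IsSymmetricBody K) :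
    1 ≤ mahlerVolume K := by
  have hK_univ : K = univ :=
    eq_univ_of_forall fun x ↦ Subsingleton.elim 0 x ▸ mem_of_mem_nhds hK.mem_nhds_zero
  have hpolar_univ : polar K = univ := eq_univ_of_forall fun y x _ ↦ by simp
  rw [mahlerVolume, hpolar_univ, hK_univ]
  simp [measureReal_def, volume_pi]

lemma IsSymmetricBody.isEquipartitioned {n : ℕ} [Subsingleton (Fin n)] {K : Set (Fin n → ℝ)}
    (hK : IsSymmetricBody K) : IsEquipartitioned K := by
  refine isEquipartitioned_of_forall_signs_smul_mem hK.measurableSet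
    hK.isCompact.measure_lt_top.ne fun ε x hx ↦ ?_
  obtain h | h : (∀ j, ε j = 1) ∨ ∀ j, ε j = -1 := by
    cases isEmpty_or_nonempty (Fin n) with
    | inl _ => exact Or.inl isEmptyElim
    | inr hne =>
      obtain ⟨i⟩ := hne
      exact (Int.units_eq_one_or (ε i)).imp (fun h j ↦ Subsingleton.elim i j ▸ h)
        fun h j ↦ Subsingleton.elim i j ▸ h
  · have hx' : ε • x = x := funext fun j ↦ by simp [h j]
    rwa [hx']
  · have hx' : ε • x = -x := funext fun j ↦ by simp [h j, Units.neg_smul]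
    exact hx' ▸ hK.neg_mem x hx

theorem IsSymmetricBody.four_le_mahlerVolume {K : Set (Fin 1 → ℝ)} (hK : IsSymmetricBody K) :
    4 ≤ mahlerVolume K := by
  have h := hK.four_mul_le_mahlerVolume (fun S hS ↦ hS.one_le_mahlerVolume)
    hK.isEquipartitioned fun i ↦ (hK.coordSlice i).isEquipartitioned
  simpa using h

theorem IsSymmetricBody.eight_le_mahlerVolume {K : Set (Fin 2 → ℝ)} (hK : IsSymmetricBody K) :
    8 ≤ mahlerVolume K := by
  have := isNegInvariant_restrict (μ := volume) hK.measurableSet hK.neg_mem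
  have := isFiniteMeasure_restrict.2 (hK.isCompact.measure_lt_top (μ := volume)).ne
  obtain ⟨e, he⟩ := exists_equipartition (μ := volume.restrict K) (ν := volume.restrict K)
    Measure.restrict_le_self.absolutelyContinuous Measure.restrict_le_self.absolutelyContinuous
    fun u v hne ↦ by
      rw [Measure.restrict_apply (isOpen_wedge u v).measurableSet, inter_comm]
      exact measure_inter_pos_of_cone volume hK.mem_nhds_zero (isOpen_wedge u v) hne
        fun t ht p ↦ smul_mem_wedge ht
  have hpart : IsEquipartitioned (e '' K) := isEquipartitioned_image e fun ε ↦ by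
    have h := (he ε).1
    rw [measureReal_restrict_apply ((isOpen_orthant ε).preimage e.continuous).measurableSet,
      measureReal_restrict_apply_univ, inter_comm] at h
    norm_num [h]
  have hbody := hK.image e
  have h := hbody.four_mul_le_mahlerVolume (fun S hS ↦ hS.four_le_mahlerVolume) hpart
    fun i ↦ (hbody.coordSlice i).isEquipartitioned
  rw [mahlerVolume_image] at h
  norm_num at h
  linarith

end LowDimensions

section ReflectionInvariantBodies

variable {n : ℕ} (i : Fin (n + 1))

lemma exists_continuousLinearEquiv_insertNth (e : (Fin n → ℝ) ≃L[ℝ] (Fin n → ℝ)) :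
    ∃ E : (Fin (n + 1) → ℝ) ≃L[ℝ] (Fin (n + 1) → ℝ),
      ∀ s p, E (i.insertNth s p) = i.insertNth s (e p) := by
  let c : (ℝ × (Fin n → ℝ)) ≃ₗ[ℝ] (Fin (n + 1) → ℝ) :=
    { Fin.insertNthEquiv (fun _ ↦ ℝ) i with
      map_add' := fun q r ↦ Fin.insertNth_add (α := fun _ ↦ ℝ) i q.1 r.1 q.2 r.2
      map_smul' := fun t q ↦ insertNth_smul i t q.1 q.2 }
  refine ⟨(c.symm.trans (((LinearEquiv.refl ℝ ℝ).prodCongr e.toLinearEquiv).trans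
    c)).toContinuousLinearEquiv, fun s p ↦ ?_⟩
  have hc : c.symm (i.insertNth s p) = (s, p) := c.symm_apply_apply (s, p)
  change c ((LinearEquiv.refl ℝ ℝ).prodCongr e.toLinearEquiv (c.symm (i.insertNth s p))) = _
  rw [hc]
  rfl

variable {i} {K : Set (Fin (n + 1) → ℝ)}

lemma mulSingle_smul_insertNth (s : ℝ) (p : Fin n → ℝ) :
    (Pi.mulSingle i (-1) : Fin (n + 1) → ℤˣ) • (i.insertNth s p : Fin (n + 1) → ℝ) =
      i.insertNth (-s) p := by
  simp [funext_iff, Fin.forall_iff_succAbove i]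

lemma mulSingle_smul_mem_image {e : (Fin n → ℝ) ≃L[ℝ] (Fin n → ℝ)}
    {E : (Fin (n + 1) → ℝ) ≃L[ℝ] (Fin (n + 1) → ℝ)}
    (hE : ∀ s p, E (i.insertNth s p) = i.insertNth s (e p))
    (hflip : ∀ x ∈ K, (Pi.mulSingle i (-1) : Fin (n + 1) → ℤˣ) • x ∈ K) :
    ∀ x ∈ E '' K, (Pi.mulSingle i (-1) : Fin (n + 1) → ℤˣ) • x ∈ E '' K := by
  rintro _ ⟨x, hx, rfl⟩
  refine ⟨_, hflip x hx, ?_⟩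
  rw [← i.insertNth_self_removeNth x, mulSingle_smul_insertNth, hE, hE, mulSingle_smul_insertNth]

lemma coordSlice_image {e : (Fin n → ℝ) ≃L[ℝ] (Fin n → ℝ)}
    {E : (Fin (n + 1) → ℝ) ≃L[ℝ] (Fin (n + 1) → ℝ)}
    (hE : ∀ s p, E (i.insertNth s p) = i.insertNth s (e p)) :
    coordSlice i (E '' K) = e '' coordSlice i K := by
  ext p
  have hp : (i.insertNth 0 p : Fin (n + 1) → ℝ) = E (i.insertNth 0 (e.symm p)) := by
    rw [hE, e.apply_symm_apply]
  rw [e.image_eq_preimage_symm]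
  change (i.insertNth 0 p : Fin (n + 1) → ℝ) ∈ E '' K ↔ _
  rw [hp, E.injective.mem_set_image]
  rfl

lemma isEquipartitioned_image_of_reflection (hK : IsSymmetricBody K)
    (hflip : ∀ x ∈ K, (Pi.mulSingle i (-1) : Fin (n + 1) → ℤˣ) • x ∈ K)
    {e : (Fin n → ℝ) ≃L[ℝ] (Fin n → ℝ)} {E : (Fin (n + 1) → ℝ) ≃L[ℝ] (Fin (n + 1) → ℝ)}
    (hE : ∀ s p, E (i.insertNth s p) = i.insertNth s (e p))
    (h : ∀ ε, 2 ^ n * volume.real (K ∩ i.removeNth ⁻¹' (e ⁻¹' orthant ε)) = volume.real K) :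
    IsEquipartitioned (E '' K) := by
  intro ε
  have hbody := hK.image E
  have hpre : E ⁻¹' (i.removeNth ⁻¹' orthant (i.removeNth ε)) =
      i.removeNth ⁻¹' (e ⁻¹' orthant (i.removeNth ε)) := by
    ext x
    rw [← i.insertNth_self_removeNth x]
    simp only [mem_preimage, hE, Fin.removeNth_insertNth]
  rw [pow_succ, mul_assoc, two_mul_volume_real_inter_orthant_of_reflection hbody.measurableSet
    hbody.isCompact.measure_lt_top.ne (mulSingle_smul_mem_image hE hflip), ← image_inter_preimage,
    hpre, volume_real_image, volume_real_image, mul_left_comm, h]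

lemma mulSingle_smul_mem_coordSlice {j : Fin (n + 2)} {k : Fin (n + 1)}
    {K : Set (Fin (n + 2) → ℝ)}
    (hflip : ∀ x ∈ K, (Pi.mulSingle (j.succAbove k) (-1) : Fin (n + 2) → ℤˣ) • x ∈ K) :
    ∀ p ∈ coordSlice j K, (Pi.mulSingle k (-1) : Fin (n + 1) → ℤˣ) • p ∈ coordSlice j K := by
  intro p hp
  have h : (Pi.mulSingle (j.succAbove k) (-1) : Fin (n + 2) → ℤˣ) •
      (j.insertNth 0 p : Fin (n + 2) → ℝ) =
        j.insertNth 0 ((Pi.mulSingle k (-1) : Fin (n + 1) → ℤˣ) • p) := by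
    simp [funext_iff, Fin.forall_iff_succAbove j, Pi.mulSingle_apply]
  change (j.insertNth 0 _ : Fin (n + 2) → ℝ) ∈ K
  exact h ▸ hflip _ hp

lemma IsSymmetricBody.isEquipartitioned_of_reflection {S : Set (Fin 2 → ℝ)}
    (hS : IsSymmetricBody S) {k : Fin 2}
    (hflip : ∀ x ∈ S, (Pi.mulSingle k (-1) : Fin 2 → ℤˣ) • x ∈ S) : IsEquipartitioned S := by
  refine isEquipartitioned_of_forall_signs_smul_mem hS.measurableSet
    hS.isCompact.measure_lt_top.ne fun ε x hx ↦ ?_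
  have hε : ∀ (k : Fin 2) (ε : Fin 2 → ℤˣ),
      ε = 1 ∨ ε = -1 ∨ ε = Pi.mulSingle k (-1) ∨ ε = -Pi.mulSingle k (-1) := by
    decide
  have hneg (δ : Fin 2 → ℤˣ) (x : Fin 2 → ℝ) : (-δ) • x = -(δ • x) :=
    funext fun i ↦ Units.neg_smul (δ i) (x i)
  rcases hε k ε with rfl | rfl | rfl | rfl
  · rwa [one_smul]
  · rw [hneg, one_smul]
    exact hS.neg_mem x hx
  · exact hflip x hx
  · rw [hneg]
    exact hS.neg_mem _ (hflip x hx)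

lemma quasiMeasurePreserving_removeNth (i : Fin (n + 1)) :
    Measure.QuasiMeasurePreserving (fun x : Fin (n + 1) → ℝ ↦ i.removeNth x) volume volume :=
  Measure.quasiMeasurePreserving_snd.comp
    (volume_preserving_piFinSuccAbove (fun _ ↦ ℝ) i).quasiMeasurePreserving

lemma IsSymmetricBody.exists_equipartition {i : Fin 3} {K : Set (Fin 3 → ℝ)}
    (hK : IsSymmetricBody K) : ∃ e : (Fin 2 → ℝ) ≃L[ℝ] (Fin 2 → ℝ), ∀ ε : Fin 2 → ℤˣ,
      2 ^ 2 * volume.real (K ∩ i.removeNth ⁻¹' (e ⁻¹' orthant ε)) = volume.real K ∧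
      2 ^ 2 * volume.real (VolumeProduct.coordSlice i K ∩ e ⁻¹' orthant ε) =
        volume.real (VolumeProduct.coordSlice i K) := by
  have hproj := quasiMeasurePreserving_removeNth i
  have hslice := hK.coordSlice i
  have := isNegInvariant_restrict (μ := volume) hK.measurableSet hK.neg_mem
  have := isNegInvariant_restrict (μ := volume) hslice.measurableSet hslice.neg_mem
  have := isNegInvariant_map (μ := volume.restrict K) hproj.measurable fun x ↦ rfl
  have := isFiniteMeasure_restrict.2 (hK.isCompact.measure_lt_top (μ := volume)).ne
  have := isFiniteMeasure_restrict.2 (hslice.isCompact.measure_lt_top (μ := volume)).ne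
  obtain ⟨e, he⟩ := VolumeProduct.exists_equipartition
    (μ := (volume.restrict K).map fun x ↦ i.removeNth x)
    (ν := volume.restrict (VolumeProduct.coordSlice i K))
    ((Measure.restrict_le_self.absolutelyContinuous.map hproj.measurable).trans
      hproj.absolutelyContinuous)
    Measure.restrict_le_self.absolutelyContinuous
    fun u v hne ↦ by
      have hmeas := (isOpen_wedge u v).measurableSet
      rw [Measure.map_apply hproj.measurable hmeas,
        Measure.restrict_apply (hproj.measurable hmeas), inter_comm]
      exact measure_inter_pos_of_cone volume hK.mem_nhds_zero
        ((isOpen_wedge u v).preimage (continuous_removeNth i))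
        (hne.preimage fun p ↦ ⟨i.insertNth 0 p, Fin.removeNth_insertNth ..⟩)
        fun t ht x ↦ smul_mem_wedge ht
  refine ⟨e, fun ε ↦ ?_⟩
  have hmeas := ((isOpen_orthant ε).preimage e.continuous).measurableSet
  obtain ⟨hbody, hsection⟩ := he ε
  rw [map_measureReal_apply hproj.measurable hmeas,
    map_measureReal_apply hproj.measurable .univ, preimage_univ,
    measureReal_restrict_apply (hproj.measurable hmeas), measureReal_restrict_apply_univ,
    inter_comm] at hbody
  rw [measureReal_restrict_apply hmeas, measureReal_restrict_apply_univ, inter_comm] at hsection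
  norm_num [hbody, hsection]

theorem IsSymmetricBody.le_mahlerVolume_of_reflection {i : Fin 3} {K : Set (Fin 3 → ℝ)}
    (hK : IsSymmetricBody K)
    (hflip : ∀ x ∈ K, (Pi.mulSingle i (-1) : Fin 3 → ℤˣ) • x ∈ K) :
    32 / 3 ≤ mahlerVolume K := by
  obtain ⟨e, he⟩ := hK.exists_equipartition (i := i)
  obtain ⟨E, hE⟩ := exists_continuousLinearEquiv_insertNth i e
  have hbody := hK.image E
  have hslice (j : Fin 3) : IsEquipartitioned (VolumeProduct.coordSlice j (E '' K)) := by
    rcases eq_or_ne i j with rfl | hij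
    · rw [coordSlice_image hE]
      exact isEquipartitioned_image e fun ε ↦ (he ε).2
    · obtain ⟨k, rfl⟩ := Fin.exists_succAbove_eq hij
      exact (hbody.coordSlice j).isEquipartitioned_of_reflection
        (mulSingle_smul_mem_coordSlice (mulSingle_smul_mem_image hE hflip))
  have h := hbody.four_mul_le_mahlerVolume (fun S hS ↦ hS.eight_le_mahlerVolume)
    (isEquipartitioned_image_of_reflection hK hflip hE fun ε ↦ (he ε).1) hslice
  rw [mahlerVolume_image] at h
  norm_num at h
  linarith

end ReflectionInvariantBodies

section ProjectiveMaps

variable {E : Type*} [NormedAddCommGroup E] [NormedSpace ℝ E] {f : StrongDual ℝ E}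

/-- The projective map `y ↦ y / (1 - f y)`, which carries the polar of a body with respect to the
origin into its polar with respect to another point. It is meaningful where `f y ≠ 1`. -/
noncomputable def projectiveMap (f : StrongDual ℝ E) (y : E) : E := (1 - f y)⁻¹ • y

lemma hasFDerivAt_projectiveMap {y : E} (hy : f y ≠ 1) :
    HasFDerivAt (projectiveMap f) ((1 - f y)⁻¹ •
      (ContinuousLinearMap.id ℝ E + f.smulRight ((1 - f y)⁻¹ • y))) y := by
  have hinv : HasFDerivAt (fun x ↦ (1 - f x)⁻¹) ((1 - f y)⁻¹ ^ 2 • f) y := by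
    have h := (hasDerivAt_inv (sub_ne_zero.2 hy.symm)).comp_hasFDerivAt y
      (f.hasFDerivAt.const_sub 1)
    rwa [smul_neg, neg_smul, neg_neg, ← inv_pow] at h
  refine (hinv.smul (hasFDerivAt_id y)).congr_fderiv (ContinuousLinearMap.ext fun v ↦ ?_)
  simp only [add_apply, smul_apply,
    ContinuousLinearMap.smulRight_apply, ContinuousLinearMap.id_apply, id_eq, smul_eq_mul]
  module

lemma det_smul_id_add_smulRight (f : StrongDual ℝ E) [FiniteDimensional ℝ E] (c : ℝ) (y : E) :
    (c • (ContinuousLinearMap.id ℝ E + f.smulRight y)).det =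
      c ^ Module.finrank ℝ E * (1 + f y) := by
  have h : ((c • (ContinuousLinearMap.id ℝ E + f.smulRight y) : E →L[ℝ] E) : E →ₗ[ℝ] E) =
      c • LinearMap.transvection (f : E →ₗ[ℝ] ℝ) y := rfl
  rw [ContinuousLinearMap.det, h, LinearMap.det_smul, LinearMap.transvection.det]
  rfl

lemma injOn_projectiveMap : InjOn (projectiveMap f) {y | f y ≠ 1} := by
  intro x hx y hy hxy
  have hx' : 1 - f x ≠ 0 := sub_ne_zero.2 (Ne.symm hx)
  have hy' : 1 - f y ≠ 0 := sub_ne_zero.2 (Ne.symm hy)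
  have hf := congrArg f hxy
  simp only [projectiveMap, map_smul, smul_eq_mul] at hf
  have heq : f x = f y := by
    field_simp at hf
    linarith
  simpa only [projectiveMap, heq, smul_right_injective E (inv_ne_zero hy') |>.eq_iff] using hxy

lemma two_le_inv_pow_add_inv_pow {a : ℝ} (ha : |a| < 1) (m : ℕ) :
    2 ≤ (1 - a)⁻¹ ^ m + (1 + a)⁻¹ ^ m := by
  obtain ⟨hlt, hgt⟩ := abs_lt.1 ha
  have hp : 0 < (1 - a)⁻¹ ^ m := pow_pos (inv_pos.2 (by linarith)) m
  have hq : 0 < (1 + a)⁻¹ ^ m := pow_pos (inv_pos.2 (by linarith)) m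
  have hpq : 1 ≤ (1 - a)⁻¹ ^ m * (1 + a)⁻¹ ^ m := by
    rw [← mul_pow, ← mul_inv]
    exact one_le_pow₀ ((one_le_inv₀ (by nlinarith)).2 (by nlinarith [sq_nonneg a]))
  nlinarith [sq_nonneg ((1 - a)⁻¹ ^ m - (1 + a)⁻¹ ^ m)]

variable [MeasurableSpace E] [BorelSpace E] {μ : Measure E}

theorem measure_le_measure_image_projectiveMap [FiniteDimensional ℝ E] [μ.IsAddHaarMeasure]
    {S : Set E} (hS : MeasurableSet S) (hneg : ∀ y ∈ S, -y ∈ S) (hf : ∀ y ∈ S, f y < 1) :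
    μ S ≤ μ (projectiveMap f '' S) := by
  have habs (y : E) (hy : y ∈ S) : |f y| < 1 :=
    abs_lt.2 ⟨neg_lt.1 (map_neg f y ▸ hf _ (hneg y hy)), hf y hy⟩
  have hdet (y : E) (hy : y ∈ S) : ((1 - f y)⁻¹ •
      (ContinuousLinearMap.id ℝ E + f.smulRight ((1 - f y)⁻¹ • y))).det =
        (1 - f y)⁻¹ ^ (Module.finrank ℝ E + 1) := by
    have hne : 1 - f y ≠ 0 := (sub_pos.2 (hf y hy)).ne'
    rw [det_smul_id_add_smulRight, map_smul, smul_eq_mul, pow_succ]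
    congr 1
    field_simp
    ring
  rw [← lintegral_abs_det_fderiv_eq_addHaar_image μ hS
    (fun y hy ↦ (hasFDerivAt_projectiveMap (hf y hy).ne).hasFDerivWithinAt)
    (injOn_projectiveMap.mono fun y hy ↦ (hf y hy).ne)]
  rw [setLIntegral_congr_fun hS fun y hy ↦ by rw [hdet y hy]]
  refine measure_le_setLIntegral_of_two_le hS hneg (by fun_prop) fun y hy ↦ ?_
  have hadd := two_le_inv_pow_add_inv_pow (habs y hy) (Module.finrank ℝ E + 1)
  rw [map_neg, sub_neg_eq_add, ← ENNReal.ofReal_add (abs_nonneg _) (abs_nonneg _),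
    ← ENNReal.ofReal_ofNat]
  exact ENNReal.ofReal_le_ofReal (hadd.trans (add_le_add (le_abs_self _) (le_abs_self _)))

end ProjectiveMaps

section PolarBodies

variable {n : ℕ} {K : Set (EuclideanSpace ℝ (Fin n))} {z : EuclideanSpace ℝ (Fin n)}

lemma isClosed_polarBody (K : Set (EuclideanSpace ℝ (Fin n))) (z : EuclideanSpace ℝ (Fin n)) :
    IsClosed (polarBody K z) := by
  simp only [polarBody, ofPred_forall]
  exact isClosed_biInter fun x _ ↦ isClosed_le (by fun_prop) continuous_const

lemma neg_mem_polarBody_zero (hneg : ∀ x ∈ K, -x ∈ K) :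
    ∀ y ∈ polarBody K 0, -y ∈ polarBody K 0 := by
  intro y hy x hx
  simpa using hy (-x) (hneg x hx)

lemma inner_lt_one_of_mem_interior (hz : z ∈ interior K) {y : EuclideanSpace ℝ (Fin n)}
    (hy : y ∈ polarBody K 0) : inner ℝ z y < 1 := by
  have htend : Filter.Tendsto (fun t : ℝ ↦ t • z) (nhdsWithin 1 (Ioi 1)) (nhds z) := by
    have h : ContinuousAt (fun t : ℝ ↦ t • z) 1 := by fun_prop
    simpa using h.tendsto.mono_left nhdsWithin_le_nhds
  obtain ⟨t, htK, ht⟩ :=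
    ((htend.eventually_mem (mem_interior_iff_mem_nhds.1 hz)).and self_mem_nhdsWithin).exists
  have h := hy _ htK
  rw [sub_zero, sub_zero, real_inner_smul_right, real_inner_comm] at h
  nlinarith

lemma projectiveMap_add_mem_polarBody {y : EuclideanSpace ℝ (Fin n)} (hy : y ∈ polarBody K 0)
    (hyz : inner ℝ z y < 1) : projectiveMap (innerSL ℝ z) y + z ∈ polarBody K z := by
  intro x hx
  have h := hy x hx
  rw [sub_zero, sub_zero] at h
  rw [add_sub_cancel_right, projectiveMap, real_inner_smul_left, inner_sub_right,
    innerSL_apply_apply, inv_mul_le_iff₀ (sub_pos.2 hyz), mul_one, real_inner_comm z y]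
  exact sub_le_sub_right h _

theorem volume_polarBody_zero_le (hneg : ∀ x ∈ K, -x ∈ K) (hz : z ∈ interior K) :
    volume (polarBody K 0) ≤ volume (polarBody K z) := by
  have hlt (y : EuclideanSpace ℝ (Fin n)) (hy : y ∈ polarBody K 0) : innerSL ℝ z y < 1 :=
    inner_lt_one_of_mem_interior hz hy
  calc volume (polarBody K 0) ≤ volume (projectiveMap (innerSL ℝ z) '' polarBody K 0) :=
        measure_le_measure_image_projectiveMap (isClosed_polarBody K 0).measurableSet
          (neg_mem_polarBody_zero hneg) hlt
    _ ≤ volume ((fun y ↦ y + z) ⁻¹' polarBody K z) := measure_mono <| image_subset_iff.2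
        fun y hy ↦ projectiveMap_add_mem_polarBody hy (hlt y hy)
    _ = volume (polarBody K z) := measure_preimage_add_right volume z _

end PolarBodies

section Reflections

variable {E : Type*} [NormedAddCommGroup E] [InnerProductSpace ℝ E]

lemma eq_zero_of_forall_add_mem {K : Set E} (hK : IsCompact K) (hne : K.Nonempty) {v : E}
    (hv : ∀ x ∈ K, x + v ∈ K) : v = 0 := by
  obtain ⟨x, hx, hmax⟩ := hK.exists_isMaxOn hne (f := fun x ↦ inner ℝ v x) (by fun_prop)
  have h : inner ℝ v (x + v) ≤ inner ℝ v x := hmax (hv x hx)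
  rw [inner_add_right, add_le_iff_nonpos_right] at h
  exact real_inner_self_nonpos.1 h

-- The reflections in `P` and in `-P` both preserve `K`, and they compose to a translation, which is
-- trivial by compactness; hence the origin lies on `P`.
lemma reflection_direction_mem_of_reflection_mem {K : Set E} (hK : IsCompact K)
    (hne : K.Nonempty) (hneg : ∀ x ∈ K, -x ∈ K) (P : AffineSubspace ℝ E) [Nonempty P]
    [P.direction.HasOrthogonalProjection]
    (hrefl : ∀ x ∈ K, EuclideanGeometry.reflection P x ∈ K) :
    ∀ x ∈ K, P.direction.reflection x ∈ K := by
  obtain ⟨p⟩ := ‹Nonempty P›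
  set R := P.direction.reflection
  set c : E := p - R p with hc
  have haffine (x : E) : EuclideanGeometry.reflection P x = R x + c := by
    rw [EuclideanGeometry.reflection_apply_of_mem P x p.2, vsub_eq_sub, vadd_eq_add, map_sub, hc]
    abel
  have hRR (x : E) : R (R x) = x := P.direction.reflection_reflection x
  have hRc : R c = -c := by
    rw [hc, map_sub, hRR, neg_sub]
  have htwo : (2 : ℝ) • c = 0 := eq_zero_of_forall_add_mem hK hne fun x hx ↦ by
    have h := hrefl _ (hneg _ (hrefl _ (hneg x hx)))
    rw [haffine, haffine, map_neg, map_add, map_neg, map_neg, hRR, hRc] at h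
    convert h using 1
    module
  have hc_zero : c = 0 := (smul_eq_zero_iff_right two_ne_zero).1 htwo
  intro x hx
  simpa only [haffine, hc_zero, add_zero] using hrefl x hx

lemma exists_orthonormalBasis_reflection [FiniteDimensional ℝ E] {ι : Type*} [Fintype ι]
    [DecidableEq ι] (hι : Module.finrank ℝ E = Fintype.card ι) (i : ι) {D : Submodule ℝ E}
    (hD : Module.finrank ℝ Dᗮ = 1) :
    ∃ b : OrthonormalBasis ι ℝ E, ∀ x k,
      b.repr (D.reflection x) k = (Pi.mulSingle i (-1) : ι → ℤˣ) k • b.repr x k := by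
  have : Nontrivial Dᗮ := Module.nontrivial_of_finrank_eq_succ hD
  obtain ⟨u, hu⟩ := exists_norm_eq Dᗮ zero_le_one
  have hspan := (finrank_eq_one_iff_of_nonzero' u (norm_ne_zero_iff.1 (hu ▸ one_ne_zero))).1 hD
  obtain ⟨b, hb⟩ := Orthonormal.exists_orthonormalBasis_extension_of_card_eq (𝕜 := ℝ) hι
    (v := fun _ ↦ (u : E)) (s := {i}) ⟨fun _ ↦ hu, fun _ _ hij ↦ (hij (Subsingleton.elim _ _)).elim⟩
  have hbi : b i = u := hb i rfl
  have hmem (k : ι) (hk : k ≠ i) : b k ∈ D := by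
    rw [← D.orthogonal_orthogonal, Submodule.mem_orthogonal]
    intro w hw
    obtain ⟨c, hc⟩ := hspan ⟨w, hw⟩
    have hwc : w = c • b i := by
      rw [hbi]
      exact congrArg Subtype.val hc.symm
    rw [hwc, real_inner_smul_left, b.orthonormal.2 hk.symm, mul_zero]
  refine ⟨b, fun x k ↦ ?_⟩
  have hadj : inner ℝ (b k) (D.reflection x) = inner ℝ (D.reflection (b k)) x := by
    rw [← D.reflection.inner_map_map, D.reflection_reflection]
  rw [b.repr_apply_apply, b.repr_apply_apply, hadj]
  rcases eq_or_ne k i with rfl | hk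
  · rw [Submodule.reflection_mem_subspace_orthogonalComplement_eq_neg (hbi ▸ u.2), inner_neg_left,
      Pi.mulSingle_eq_same, Units.neg_smul, one_smul]
  · rw [Submodule.reflection_mem_subspace_eq_self (hmem k hk), Pi.mulSingle_eq_of_ne hk, one_smul]

end Reflections

section OrthonormalCoordinates

variable {n : ℕ} (b : OrthonormalBasis (Fin n) ℝ (EuclideanSpace ℝ (Fin n)))
  {K : Set (EuclideanSpace ℝ (Fin n))}

/-- The coordinates with respect to an orthonormal basis, as a map to the function space `ℝⁿ` on
which the Mahler volume is defined. -/
noncomputable def coords : EuclideanSpace ℝ (Fin n) ≃L[ℝ] (Fin n → ℝ) :=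
  b.repr.toContinuousLinearEquiv.trans (PiLp.continuousLinearEquiv 2 ℝ fun _ ↦ ℝ)

lemma coords_dotProduct_coords (x y : EuclideanSpace ℝ (Fin n)) :
    coords b x ⬝ᵥ coords b y = inner ℝ x y := by
  rw [← b.repr.inner_map_map, EuclideanSpace.inner_eq_star_dotProduct, star_trivial,
    dotProduct_comm]
  rfl

lemma volume_coords_image (S : Set (EuclideanSpace ℝ (Fin n))) :
    volume (coords b '' S) = volume S := by
  have hmp : MeasurePreserving (coords b).toHomeomorph.toMeasurableEquiv volume volume :=
    (PiLp.volume_preserving_ofLp (Fin n)).comp b.measurePreserving_repr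
  rw [← hmp.measure_preimage_equiv]
  exact congrArg volume (preimage_image_eq S (coords b).injective)

lemma polar_coords_image (K : Set (EuclideanSpace ℝ (Fin n))) :
    polar (coords b '' K) = coords b '' polarBody K 0 := by
  ext w
  obtain ⟨y, rfl⟩ := (coords b).surjective w
  rw [(coords b).injective.mem_set_image]
  simp only [polar, polarBody, mem_ofPred_eq, forall_mem_image, coords_dotProduct_coords, sub_zero]

lemma isSymmetricBody_of_isCentrallySymmetric (hK : IsConvexBody K)
    (hcentral : IsCentrallySymmetric K) : IsSymmetricBody K where
  convex := hK.convex
  isCompact := hK.isCompact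
  neg_mem x hx := by
    have h : K = -K := hcentral
    rwa [h, Set.neg_mem_neg]
  mem_nhds_zero := by
    obtain ⟨z, hz⟩ := hK.interior_nonempty
    have hnegz : -z ∈ interior K := by
      have h : K = -K := hcentral
      have hint : interior (-K) = -interior K := ((Homeomorph.neg _).preimage_interior K).symm
      rwa [h, hint, Set.neg_mem_neg]
    have h := hK.convex.interior.midpoint_mem hz hnegz
    rw [midpoint_self_neg] at h
    exact mem_interior_iff_mem_nhds.1 h

lemma ofReal_mahlerVolume_coords_image (hK : IsSymmetricBody K) :
    ENNReal.ofReal (mahlerVolume (coords b '' K)) = volume K * volume (polarBody K 0) := by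
  have hbody := hK.image (coords b)
  rw [mahlerVolume, ENNReal.ofReal_mul measureReal_nonneg,
    ofReal_measureReal hbody.isCompact.measure_lt_top.ne,
    ofReal_measureReal (isCompact_polar hbody.mem_nhds_zero).measure_lt_top.ne,
    polar_coords_image, volume_coords_image, volume_coords_image]

end OrthonormalCoordinates

end VolumeProduct

open VolumeProduct in
theorem mainTheorem5_general (K : Set (EuclideanSpace ℝ (Fin 3)))
    (hK : IsConvexBody K) (hcentral : IsCentrallySymmetric K)
    (P : AffineSubspace ℝ (EuclideanSpace ℝ (Fin 3))) [Nonempty P]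
    (hP : Module.finrank ℝ P.direction = 2)
    (hsymm : EuclideanGeometry.reflection P '' K = K) :
    (32 / 3 : ℝ≥0∞) ≤ volumeProduct K := by
  have hbody := isSymmetricBody_of_isCentrallySymmetric hK hcentral
  have hrefl := reflection_direction_mem_of_reflection_mem hK.isCompact
    (hK.interior_nonempty.mono interior_subset) hbody.neg_mem P
    (image_subset_iff.1 hsymm.subset)
  have hnormal : Module.finrank ℝ P.directionᗮ = 1 :=
    Submodule.finrank_add_finrank_orthogonal' (by rw [hP, finrank_euclideanSpace_fin])
  obtain ⟨b, hb⟩ := exists_orthonormalBasis_reflection finrank_euclideanSpace (0 : Fin 3) hnormal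
  have hmahler := (hbody.image (coords b)).le_mahlerVolume_of_reflection (i := 0)
    (forall_mem_image.2 fun x hx ↦ ⟨_, hrefl x hx, funext (hb x)⟩)
  refine le_iInf₂ fun z hz ↦ ?_
  calc (32 / 3 : ℝ≥0∞) = ENNReal.ofReal (32 / 3) := by
        rw [ENNReal.ofReal_div_of_pos three_pos, ENNReal.ofReal_ofNat, ENNReal.ofReal_ofNat]
    _ ≤ ENNReal.ofReal (mahlerVolume (coords b '' K)) := ENNReal.ofReal_le_ofReal hmahler
    _ = volume K * volume (polarBody K 0) := ofReal_mahlerVolume_coords_image b hbody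
    _ ≤ volume K * volume (polarBody K z) :=
        mul_le_mul_right (volume_polarBody_zero_le hbody.neg_mem hz) _

theorem mainTheorem5 (K : Set (EuclideanSpace ℝ (Fin 3)))
    (hK : IsConvexBody K) (hcentral : IsCentrallySymmetric K)
    (hsmooth : IsSmoothHypersurface (frontier K)) (hstrong : IsStronglyConvexBody K)
    (P : AffineSubspace ℝ (EuclideanSpace ℝ (Fin 3))) [Nonempty P]
    (hP : Module.finrank ℝ P.direction = 2)
    (hsymm : EuclideanGeometry.reflection P '' K = K) :
    (32 / 3 : ℝ≥0∞) ≤ volumeProduct K :=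
  mainTheorem5_general K hK hcentral P hP hsymm
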